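/- For $n\ge 0$ let $AD_n$ be the Aztec diamond graph of order $n$, drawn rotated by $45^\circ$: its vertices are the integer points $(i,j)$, $0\le i,j\le 2n$, with $i+j$ odd ($i$ increasing downwards and $j$ to the right), and two vertices $(i,j)$, $(i',j')$ are adjacent iff $|i-i'|=|j-j'|=1$. The centers of the edges form a $2n\times 2n$ array. For a $k\times l$ matrix $A$ with $k,l$ even, the weighted graph $AD_n(\mathrm{wt}_A)$ is obtained by placing a copy of $A$ in the upper left corner of this array, continuing it periodically (with vertical period $k$ and horizontal period $l$), and giving each edge the entry at its center as weight. Let $M(G)$ be the sum, over all perfect matchings of the weighted graph $G$, of the product of the weights of the edges of the matching (so $M(AD_0)=1$). **Theorem.** Let $a,b,c,d,x,y,z,t>0$ be real numbers and $$N=\begin{bmatrix} a&b&x&y&b&a&y&x\\ d&c&t&z&c&d&z&t\\ x&y&a&b&y&x&b&a\\ t&z&d&c&z&t&c&d \end{bmatrix}.$$ Put $\Delta_1=ac+bd$, $\Delta_2=xz+yt$, $\Delta_0=\Delta_1+\Delta_2$, $C_1=xt\Delta_1^2+ad\Delta_2^2$, $C_2=yz\Delta_1^2+bc\Delta_2^2$,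 $C_3=ac\Delta_2^2+yt\Delta_1^2$, and write $M_m=M(AD_m(\mathrm{wt}_N))$. Then for every $n\ge 2$ $$\frac{M_{4n}}{M_{4n-8}}=\Delta_0^{8n-8}(ad+xt)^{2n-2}(bc+yz)^{2n-4}C_1^{2n}C_2^{2n-2}\,a^{2n-1}b^{2n-3}c^{2n-3}d^{2n-1}x^{2n-1}y^{2n-3}z^{2n-3}t^{2n-1},$$ $$\frac{M_{4n+1}}{M_{4n-7}}=\Delta_0^{8n-6}(ad+xt)^{2n-2}(bc+yz)^{2n-3}C_1^{2n}C_2^{2n-1}\,a^{2n-1}b^{2n-2}c^{2n-2}d^{2n-1}x^{2n-1}y^{2n-2}z^{2n-2}t^{2n-1},$$ $$\frac{M_{4n+2}}{M_{4n-6}}=\Delta_0^{8n-4}(ad+xt)^{2n-2}(bc+yz)^{2n-2}C_1^{2n}C_2^{2n}\,a^{2n-1}b^{2n-1}c^{2n-1}d^{2n-1}x^{2n-1}y^{2n-1}z^{2n-1}t^{2n-1},$$ $$\frac{M_{4n+3}}{M_{4n-5}}=\Delta_0^{8n-2}(ad+xt)^{2n-1}(bc+yz)^{2n-2}C_1^{2n+1}C_2^{2n}\,a^{2n}b^{2n-1}c^{2n-1}d^{2n}x^{2n}y^{2n-1}z^{2n-1}t^{2n},$$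 and the initial values are $$M_0=1,\quad M_1=\Delta_1,\quad M_2=C_3,\quad M_3=ad\,\Delta_0\Delta_2C_1,\quad M_4=adxt\,\Delta_0^2C_1^2,\quad M_5=abcdxt\,\Delta_0^3C_1^2C_2,$$ $$M_6=abcdxyzt\,\Delta_0^4(bd+xz)C_1^2C_2^2,\qquad M_7=a^2bcd^2x^2yzt^2\,\Delta_0^6(ad+xt)C_1^3C_2^2.$$ -/

import Mathlib

/-- The matching generating function of a weighted finite graph: the sum over all perfect
matchings of the product of the weights of their edges. -/
noncomputable def matchingGenFun {V : Type*} [Fintype V] (G : SimpleGraph V)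
    (wt : Sym2 V → ℝ) : ℝ :=
  open Classical in
  ∑ M : {M : G.Subgraph // M.IsPerfectMatching}, ∏ e ∈ M.1.edgeSet.toFinset, wt e

/-- The vertices of the Aztec diamond graph of order `n`, drawn with diagonal edges: the lattice
points of the square `[0, 2n] × [0, 2n]` whose coordinate sum is odd. The first coordinate
increases downwards and the second one to the right, as for the entries of a matrix. -/
abbrev AztecVertex (n : ℕ) : Type :=
  {p : Fin (2 * n + 1) × Fin (2 * n + 1) // Odd ((p.1 : ℕ) + (p.2 : ℕ))}

/-- The Aztec diamond graph of order `n`: two vertices are adjacent if and only if they are the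
endpoints of a diagonal of a unit square. Each of the `2n × 2n` unit squares
`[r, r + 1] × [s, s + 1]` with `r, s < 2n` contains exactly one edge, and the edge is centred at
the centre of its square. -/
def aztecGraph (n : ℕ) : SimpleGraph (AztecVertex n) where
  Adj u v :=
    ((u.1.1 : ℕ) + 1 = v.1.1 ∨ (v.1.1 : ℕ) + 1 = u.1.1) ∧
      ((u.1.2 : ℕ) + 1 = v.1.2 ∨ (v.1.2 : ℕ) + 1 = u.1.2)
  symm := ⟨fun _ _ h => ⟨h.1.symm, h.2.symm⟩⟩
  loopless := ⟨fun u h => by rcases h.1 with h | h <;> omega⟩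

/-- The edge weights of the Aztec diamond graph of order `n` given by a weight matrix `W` (rows and
columns indexed from `0`; only the entries with indices less than `2n` matter): the edge in the
unit square `[r, r + 1] × [s, s + 1]` has weight `W r s`. -/
def aztecWeight (n : ℕ) (W : ℕ → ℕ → ℝ) : Sym2 (AztecVertex n) → ℝ :=
  Sym2.lift ⟨fun u v => W (min (u.1.1 : ℕ) v.1.1) (min (u.1.2 : ℕ) v.1.2), fun u v => by
    simp only [min_comm]⟩

/-- The periodic weight matrix with period `A`, a copy of `A` being in the upper left corner. -/
def periodicWeight {k l : ℕ} [NeZero k] [NeZero l] (A : Matrix (Fin k) (Fin l) ℝ) :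
    ℕ → ℕ → ℝ :=
  fun i j => A (Fin.ofNat k i) (Fin.ofNat l j)

/-- The matching generating function of the Aztec diamond graph of order `n` with weight
pattern `A`. -/
noncomputable def aztecM {k l : ℕ} [NeZero k] [NeZero l] (n : ℕ)
    (A : Matrix (Fin k) (Fin l) ℝ) : ℝ :=
  matchingGenFun (aztecGraph n) (aztecWeight n (periodicWeight A))

/-- The weight pattern `N`. -/
def patternN (a b c d x y z t : ℝ) : Matrix (Fin 4) (Fin 8) ℝ :=
  !![a, b, x, y, b, a, y, x;
     d, c, t, z, c, d, z, t;
     x, y, a, b, y, x, b, a;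
     t, z, d, c, z, t, c, d]

/-! The proof is urban renewal iterated through a cycle of eight weight patterns. The `2n × 2n`
array of edges splits into `n × n` cells, blocks of four edges forming a four-cycle. A cell meets
the rest of the graph only at its four corners, so all that matters is the total weight of the cell
matchings covering a given set of corners. If each edge weight is replaced by the opposite one
divided by `Δ`, the weight of the two perfect matchings of the cell, these totals are reproduced up
to the factor `Δ`, with the complementary set of corners (`cellSum_compl`).

A corner shared by two cells is covered in exactly one of them, a condition that complementation
preserves. A boundary corner belongs to one cell only, and there "covered" turns into "uncovered".
Renewal in all cells therefore deletes the boundary and leaves a diamond of order one less. Since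
every vertex lies on exactly one matching edge, scaling the weights at a vertex scales the total by
the same factor, and this freedom normalises the new weights. Together this is the reduction
`diamondSum_succ`.

For `N` the renewed weights stay periodic, and after eight renewals `N` returns exactly. What keeps
the patterns simple is that every cell weight factors, by the definitions of `Δ₁`, `Δ₂`, `C₁`, `C₂`,
`C₃` and by two identities: with `r = C₃` and `s = b d Δ₂² + x z Δ₁²` one has `r + s = Δ₀ Δ₁ Δ₂`,
and `(b d + x z) + (a c + y t) = Δ₀`.

Hence `M_{k+8} / M_k` is a product of cell weights and vertex factors, each to a power counting the
positions of its residue class. Logarithms turn this into a sum that is linear in the logarithms of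
the factors, with coefficients polynomial in `m` when `k = 4m + c`. The quadratic terms and the
contributions of `Δ₁`, `Δ₂`, `r`, `s`, `b d + x z` and `a c + y t` cancel. For order below eight the
reduction ends at the empty diamond, of weight `1`, which gives the initial values. -/

/-! ### Urban renewal in four-cycles. -/

/-- A set of edges of a four-cycle in which no two edges share an endpoint. -/
def IsCellMatching (s : Finset (Fin 2 × Fin 2)) : Prop :=
  (s.image Prod.fst).card = s.card ∧ (s.image Prod.snd).card = s.card

instance : DecidablePred IsCellMatching := fun s =>
  inferInstanceAs (Decidable ((s.image Prod.fst).card = s.card ∧ (s.image Prod.snd).card = s.card))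

/-- The corners of a four-cycle covered by a set of its edges. -/
def cellCover (s : Finset (Fin 2 × Fin 2)) : Finset (Fin 2) × Finset (Fin 2) :=
  (s.image Prod.fst, s.image Prod.snd)

/-- The sum of the weights of the matchings of a four-cycle that cover exactly the corners `κ`. -/
def cellSum (w : Fin 2 × Fin 2 → ℝ) (κ : Finset (Fin 2) × Finset (Fin 2)) : ℝ :=
  ∑ s with IsCellMatching s ∧ cellCover s = κ, ∏ e ∈ s, w e

/-- The weight of the perfect matchings of a four-cycle. -/
def cellDet (w : Fin 2 × Fin 2 → ℝ) : ℝ := w (0, 0) * w (1, 1) + w (0, 1) * w (1, 0)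

/-- The weights of a four-cycle after urban renewal. -/
noncomputable def cellFlip (w : Fin 2 × Fin 2 → ℝ) (e : Fin 2 × Fin 2) : ℝ :=
  w (1 - e.1, 1 - e.2) / cellDet w

theorem finset_fin_two_cases :
    ∀ X : Finset (Fin 2), X = ∅ ∨ X = {0} ∨ X = {1} ∨ X = {0, 1} := by decide

theorem cellSum_eq (w : Fin 2 × Fin 2 → ℝ) (κ : Finset (Fin 2) × Finset (Fin 2))
    (l : Finset (Finset (Fin 2 × Fin 2)))
    (h : ({s | IsCellMatching s ∧ cellCover s = κ} : Finset (Finset (Fin 2 × Fin 2))) = l) :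
    cellSum w κ = ∑ s ∈ l, ∏ e ∈ s, w e := by
  rw [cellSum, h]

/-- An edge joins one of the corners top, bottom (first index) to one of left, right (second index),
so coverings with unequal numbers of the two kinds contribute nothing. The empty and the full
covering have weights `1` and `Δ`, and are exchanged because renewal inverts `Δ`. A covering by one
edge passes to that by the opposite edge, of renewed weight `w (i, j) / Δ`. -/
theorem cellSum_compl (w : Fin 2 × Fin 2 → ℝ) (hw : cellDet w ≠ 0)
    (κ : Finset (Fin 2) × Finset (Fin 2)) :
    cellSum w κ = cellDet w * cellSum (cellFlip w) κᶜ := by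
  obtain ⟨X, Y⟩ := κ
  have hdet : cellDet (cellFlip w) = (cellDet w)⁻¹ := by
    have : cellDet (cellFlip w) = cellDet w / (cellDet w * cellDet w) := by
      rw [cellDet]
      simp only [cellFlip]
      rw [div_mul_div_comm, div_mul_div_comm, ← add_div]
      congr 1
      rw [cellDet, sub_zero, sub_self]
      ring
    rw [this]; field_simp
  have full (v : Fin 2 × Fin 2 → ℝ) : cellSum v ({0, 1}, {0, 1}) = cellDet v := by
    rw [cellSum_eq v _ {{(0, 0), (1, 1)}, {(0, 1), (1, 0)}} (by decide),
      Finset.sum_pair (by decide), Finset.prod_pair (by decide), Finset.prod_pair (by decide),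
      cellDet]
  have none (v : Fin 2 × Fin 2 → ℝ) : cellSum v (∅, ∅) = 1 := by
    rw [cellSum_eq v _ {∅} (by decide)]; simp
  have one (v : Fin 2 × Fin 2 → ℝ) (i j : Fin 2) : cellSum v ({i}, {j}) = v (i, j) := by
    rw [cellSum_eq v _ {{(i, j)}} (by revert i j; decide)]; simp
  have hz (v : Fin 2 × Fin 2 → ℝ) (κ) (h : κ.1.card ≠ κ.2.card) : cellSum v κ = 0 := by
    rw [cellSum_eq v _ ∅ (by revert κ; decide)]; simp
  have hone (i j : Fin 2) : w (i, j) = cellDet w * cellFlip w (1 - i, 1 - j) := by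
    rw [cellFlip]; simp only [sub_sub_cancel]; field_simp
  have c0 : (∅ : Finset (Fin 2))ᶜ = {0, 1} := by decide
  have c1 : ({0} : Finset (Fin 2))ᶜ = {1} := by decide
  have c2 : ({1} : Finset (Fin 2))ᶜ = {0} := by decide
  have c3 : ({0, 1} : Finset (Fin 2))ᶜ = ∅ := by decide
  have hcompl : (X, Y)ᶜ = (Xᶜ, Yᶜ) := rfl
  rw [hcompl]
  rcases finset_fin_two_cases X with rfl | rfl | rfl | rfl <;>
    rcases finset_fin_two_cases Y with rfl | rfl | rfl | rfl <;>
    simp only [c0, c1, c2, c3]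
  all_goals first
    | (rw [hz _ _ (by decide), hz _ _ (by decide), mul_zero])
    | (rw [one, one, hone]; rfl)
    | (rw [none, full, hdet, mul_inv_cancel₀ hw])
    | (rw [none, full, mul_one])

/-- Urban renewal in all cells at once: the families of cell matchings whose covered corners satisfy
a condition are traded for those whose uncovered corners satisfy it. -/
theorem sum_cellMatching_compl {C : Type*} [Fintype C] [DecidableEq C]
    (w : C → Fin 2 × Fin 2 → ℝ) (hw : ∀ c, cellDet (w c) ≠ 0)
    (Q : (C → Finset (Fin 2) × Finset (Fin 2)) → Prop) [DecidablePred Q] :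
    ∑ s : C → Finset (Fin 2 × Fin 2) with (∀ c, IsCellMatching (s c)) ∧
        Q (fun c => cellCover (s c)), ∏ c, ∏ e ∈ s c, w c e =
      (∏ c, cellDet (w c)) *
        ∑ s : C → Finset (Fin 2 × Fin 2) with (∀ c, IsCellMatching (s c)) ∧
          Q (fun c => (cellCover (s c))ᶜ), ∏ c, ∏ e ∈ s c, cellFlip (w c) e := by
  -- Once the covered corners `κ` are fixed, the cells are independent, and the sum over families of
  -- matchings factors into cell sums.
  have key (v : C → Fin 2 × Fin 2 → ℝ) (R : (C → Finset (Fin 2) × Finset (Fin 2)) → Prop)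
      [DecidablePred R] :
      ∑ s : C → Finset (Fin 2 × Fin 2) with (∀ c, IsCellMatching (s c)) ∧
        R (fun c => cellCover (s c)), ∏ c, ∏ e ∈ s c, v c e =
      ∑ κ with R κ, ∏ c, cellSum (v c) (κ c) := by
    simp only [cellSum]
    rw [← Finset.sum_fiberwise_of_maps_to (t := Finset.univ.filter R)
      (g := fun s c => cellCover (s c)) (by intro s hs; simp at hs ⊢; exact hs.2)]
    refine Finset.sum_congr rfl fun κ hκ => ?_
    rw [Finset.prod_univ_sum]
    refine Finset.sum_congr ?_ fun _ _ => rfl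
    ext s
    simp only [Finset.mem_filter, Finset.mem_univ, true_and, Fintype.mem_piFinset,
      funext_iff] at hκ ⊢
    constructor
    · rintro ⟨⟨h1, -⟩, h2⟩ c
      exact ⟨h1 c, h2 c⟩
    · intro h
      refine ⟨⟨fun c => (h c).1, ?_⟩, fun c => (h c).2⟩
      convert hκ using 1
      ext c : 1
      exact (h c).2
  rw [key, key (fun c => cellFlip (w c)) (fun κ => Q (fun c => (κ c)ᶜ)), Finset.mul_sum]
  refine Finset.sum_nbij' (fun κ c => (κ c)ᶜ) (fun κ c => (κ c)ᶜ) ?_ ?_ ?_ ?_ ?_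
  · intro κ hκ; simpa using hκ
  · intro κ hκ; simpa using hκ
  · intro κ _; simp
  · intro κ _; simp
  · intro κ _
    rw [← Finset.prod_mul_distrib]
    exact Finset.prod_congr rfl fun c _ => cellSum_compl _ (hw c) _

/-! ### Perfect matchings as compatible families of cell matchings. -/

/-- Every vertex `(2i, 2j + 1)` of the Aztec diamond of order `n` (or, if `b` fails, every such
vertex off the boundary and no other one) is covered exactly once by the edges in the unit squares
marked by `m`. The vertex of this form on the edge in the square `(r, s)` is given by
`i = (r + 1) / 2` and `j = s / 2`. -/
def RowValid (n : ℕ) (b : Prop) (m : ℕ → ℕ → Prop) : Prop :=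
  (∀ r s r' s', m r s → m r' s' → (r + 1) / 2 = (r' + 1) / 2 → s / 2 = s' / 2 →
    r = r' ∧ s = s') ∧
  ∀ i ≤ n, ∀ j < n, (∃ r s, m r s ∧ (r + 1) / 2 = i ∧ s / 2 = j) ↔ (b ∨ (0 < i ∧ i < n))

theorem RowValid.congr {n : ℕ} {b : Prop} {m m' : ℕ → ℕ → Prop} (h : ∀ r s, m r s ↔ m' r s) :
    RowValid n b m ↔ RowValid n b m' := by
  have : m = m' := by ext r s; exact h r s
  rw [this]

/-- The edges at the vertex `(2i, 2j + 1)` lie in the rows `2i - 1` and `2i` of squares, in columns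
`2j` and `2j + 1`. Each row contributes two edges of a single cell, and the boundary vertices have
only one such row. Exact covering thus becomes a condition inside each cell and a condition between
vertical neighbours. -/
theorem rowValid_iff {n : ℕ} {b : Prop} {m : ℕ → ℕ → Prop} (hn : 0 < n)
    (hm : ∀ r s, m r s → r < 2 * n ∧ s < 2 * n) :
    RowValid n b m ↔
      (∀ r j, ¬(m r (2 * j) ∧ m r (2 * j + 1))) ∧
      ∀ j < n, ((m 0 (2 * j) ∨ m 0 (2 * j + 1)) ↔ b) ∧
        ((m (2 * n - 1) (2 * j) ∨ m (2 * n - 1) (2 * j + 1)) ↔ b) ∧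
        ∀ i, i + 1 < n → ((m (2 * i + 2) (2 * j) ∨ m (2 * i + 2) (2 * j + 1)) ↔
          ¬(m (2 * i + 1) (2 * j) ∨ m (2 * i + 1) (2 * j + 1))) := by
  have even_or (s : ℕ) : s = 2 * (s / 2) ∨ s = 2 * (s / 2) + 1 := by omega
  constructor
  · rintro ⟨hinj, hcov⟩
    refine ⟨fun r j ⟨h0, h1⟩ => ?_, fun j hj => ⟨?_, ?_, fun i hi => ?_⟩⟩
    · have := hinj _ _ _ _ h0 h1 rfl (by omega); omega
    · rw [← (by simp : (b ∨ (0 < 0 ∧ 0 < n)) ↔ b), ← hcov 0 (by omega) j hj]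
      constructor
      · rintro (h | h) <;> exact ⟨_, _, h, by omega, by omega⟩
      · rintro ⟨r, s, h, hr, hs⟩
        obtain rfl : r = 0 := by omega
        rcases even_or s with h' | h' <;> rw [h', hs] at h <;> simp [h]
    · rw [← (by simp : (b ∨ (0 < n ∧ n < n)) ↔ b), ← hcov n le_rfl j hj]
      constructor
      · rintro (h | h) <;> exact ⟨_, _, h, by omega, by omega⟩
      · rintro ⟨r, s, h, hr, hs⟩
        have := hm _ _ h
        obtain rfl : r = 2 * n - 1 := by omega
        rcases even_or s with h' | h' <;> rw [h', hs] at h <;> simp [h]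
    · constructor
      · rintro (h | h) (h' | h') <;> have := hinj _ _ _ _ h h' (by omega) (by omega) <;> omega
      · intro hno
        obtain ⟨r, s, h, hr, hs⟩ := (hcov (i + 1) (by omega) j hj).2 (Or.inr (by omega))
        have hr' : r = 2 * i + 2 := by
          rcases even_or s with h' | h' <;> rw [h', hs] at h
          · by_contra hne
            obtain rfl : r = 2 * i + 1 := by omega
            exact hno (Or.inl h)
          · by_contra hne
            obtain rfl : r = 2 * i + 1 := by omega
            exact hno (Or.inr h)
        subst hr'
        rcases even_or s with h' | h' <;> rw [h', hs] at h <;> simp [h]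
  · rintro ⟨hrow, hcov⟩
    have hR (r s) (h : m r s) : m r (2 * (s / 2)) ∨ m r (2 * (s / 2) + 1) := by
      rcases even_or s with h' | h' <;> rw [h'] at h <;> [left; right] <;> convert h using 1
    have hsame (r s s') (h : m r s) (h' : m r s') (hs : s / 2 = s' / 2) : s = s' := by
      by_contra hne
      refine hrow r (s / 2) ?_
      rcases even_or s with e | e <;> rcases even_or s' with e' | e'
      · omega
      · exact ⟨by rwa [← e], by rwa [hs, ← e']⟩
      · exact ⟨by rwa [hs, ← e'], by rwa [← e]⟩
      · omega
    have hadj (r s s') (h : m (r + 1) s) (h' : m r s') (hr : r % 2 = 1) (hs : s / 2 = s' / 2) :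
        False := by
      have b1 := hm _ _ h
      have b2 := hm _ _ h'
      have := (hcov (s / 2) (by omega)).2.2 (r / 2) (by omega)
      rw [show 2 * (r / 2) + 2 = r + 1 by omega, show 2 * (r / 2) + 1 = r by omega] at this
      refine this.1 (hR _ _ h) ?_
      rw [hs]; exact hR _ _ h'
    refine ⟨fun r s r' s' h h' hr hs => ?_, fun i hi j hj => ?_⟩
    · rcases lt_trichotomy r r' with hlt | rfl | hlt
      · obtain rfl : r' = r + 1 := by omega
        exact (hadj r s' s h' h (by omega) hs.symm).elim
      · exact ⟨rfl, hsame _ _ _ h h' hs⟩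
      · obtain rfl : r = r' + 1 := by omega
        exact (hadj r' s s' h h' (by omega) hs).elim
    · obtain ⟨h0, h1, h2⟩ := hcov j hj
      rcases Nat.eq_zero_or_pos i with rfl | hi0
      · simp only [lt_irrefl, false_and, or_false]
        rw [← h0]
        constructor
        · rintro ⟨r, s, h, hr, hs⟩
          obtain rfl : r = 0 := by omega
          rw [← hs]; exact hR _ _ h
        · rintro (h | h) <;> exact ⟨_, _, h, by omega, by omega⟩
      · rcases hi.eq_or_lt with rfl | hin
        · simp only [lt_irrefl, and_false, or_false]
          rw [← h1]
          constructor
          · rintro ⟨r, s, h, hr, hs⟩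
            have := hm _ _ h
            obtain rfl : r = 2 * i - 1 := by omega
            rw [← hs]; exact hR _ _ h
          · rintro (h | h) <;> exact ⟨_, _, h, by omega, by omega⟩
        · refine iff_of_true ?_ (Or.inr ⟨hi0, hin⟩)
          obtain ⟨k, rfl⟩ : ∃ k, i = k + 1 := ⟨i - 1, by omega⟩
          by_cases hk : m (2 * k + 1) (2 * j) ∨ m (2 * k + 1) (2 * j + 1)
          · rcases hk with h | h <;> exact ⟨_, _, h, by omega, by omega⟩
          · rcases (h2 k hin).2 hk with h | h <;> exact ⟨_, _, h, by omega, by omega⟩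

/-- Compatibility of the sets of covered upper (`0`) and lower (`1`) corners of the cells: a vertex
shared by two cells is covered in exactly one of them, and the boundary vertices are covered if and
only if `b` holds. -/
def RowCompatible {n : ℕ} (b : Prop) (κ : Fin n × Fin n → Finset (Fin 2)) : Prop :=
  ∀ j : Fin n, (∀ i : Fin n, (i : ℕ) = 0 → (0 ∈ κ (i, j) ↔ b)) ∧
    (∀ i : Fin n, (i : ℕ) + 1 = n → (1 ∈ κ (i, j) ↔ b)) ∧
    ∀ i i' : Fin n, (i : ℕ) + 1 = i' → (0 ∈ κ (i', j) ↔ 1 ∉ κ (i, j))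

/-- "Covered in exactly one of two cells" is symmetric under complementation, so only the boundary
condition is negated. This is what makes urban renewal remove the boundary. -/
theorem rowCompatible_compl {n : ℕ} {b : Prop} {κ : Fin n × Fin n → Finset (Fin 2)} :
    RowCompatible b (fun c => (κ c)ᶜ) ↔ RowCompatible (¬b) κ := by
  simp only [RowCompatible, Finset.mem_compl]
  refine forall_congr' fun j => and_congr ?_ (and_congr ?_ ?_)
  · exact forall₂_congr fun i _ => by tauto
  · exact forall₂_congr fun i _ => by tauto
  · exact forall₃_congr fun i i' _ => by tauto

theorem rowValid_iff_cells {n : ℕ} {b : Prop} {m : ℕ → ℕ → Prop} (hn : 0 < n)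
    (hm : ∀ r s, m r s → r < 2 * n ∧ s < 2 * n) (s : Fin n × Fin n → Finset (Fin 2 × Fin 2))
    (hs : ∀ c e, e ∈ s c ↔ m (2 * c.1 + e.1) (2 * c.2 + e.2)) :
    RowValid n b m ↔ (∀ c, ((s c).image Prod.fst).card = (s c).card) ∧
      RowCompatible b (fun c => (s c).image Prod.fst) := by
  rw [rowValid_iff hn hm]
  have hmem (c : Fin n × Fin n) (α : Fin 2) : α ∈ (s c).image Prod.fst ↔
      (m (2 * c.1 + α) (2 * c.2) ∨ m (2 * c.1 + α) (2 * c.2 + 1)) := by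
    simp [hs, Fin.exists_fin_two]
  refine and_congr ?_ ?_
  · simp only [Finset.card_image_iff]
    constructor
    · rintro h ⟨i, j⟩ ⟨α, β⟩ he ⟨α', β'⟩ he' (rfl : α = α')
      simp only [Finset.mem_coe, hs] at he he'
      have := h (2 * i + α) j
      fin_cases β <;> fin_cases β' <;> simp_all
    · rintro h r j ⟨h0, h1⟩
      have b0 := hm _ _ h0
      have e0 : ((⟨r % 2, by omega⟩, 0) : Fin 2 × Fin 2) ∈ s (⟨r / 2, by omega⟩, ⟨j,
        by omega⟩) := by
        rw [hs]; simpa [Nat.div_add_mod] using h0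
      have e1 : ((⟨r % 2, by omega⟩, 1) : Fin 2 × Fin 2) ∈ s (⟨r / 2, by omega⟩, ⟨j,
        by omega⟩) := by
        rw [hs]; simpa [Nat.div_add_mod] using h1
      have := h _ e0 e1 rfl
      simp at this
  · simp only [RowCompatible, hmem]
    constructor
    · intro h j
      obtain ⟨h0, h1, h2⟩ := h j j.2
      refine ⟨fun i hi => ?_, fun i hi => ?_, fun i i' hi => ?_⟩
      · rw [hi]; exact h0
      · have : 2 * n - 1 = 2 * (i : ℕ) + 1 := by omega
        rw [this] at h1; exact h1
      · have := h2 i (by omega)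
        rw [← hi]; exact this
    · intro h j hj
      obtain ⟨h0, h1, h2⟩ := h ⟨j, hj⟩
      refine ⟨?_, ?_, fun i hi => ?_⟩
      · exact h0 ⟨0, hn⟩ rfl
      · have : 2 * n - 1 = 2 * (n - 1) + 1 := by omega
        rw [this]; exact h1 ⟨n - 1, by omega⟩ (by simp; omega)
      · exact h2 ⟨i, by omega⟩ ⟨i + 1, hi⟩ rfl

/-- A set of edges, given by their unit squares, is a perfect matching of the Aztec diamond of order
`n` if `b` holds, and of the Aztec diamond without its boundary vertices otherwise. -/
def DiamondValid (n : ℕ) (b : Prop) (S : Finset (ℕ × ℕ)) : Prop :=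
  RowValid n b (fun r s => (r, s) ∈ S) ∧ RowValid n b (fun r s => (s, r) ∈ S)

/-- The unit squares of the Aztec diamond of order `n`. -/
def diamondSquares (n : ℕ) : Finset (ℕ × ℕ) := Finset.range (2 * n) ×ˢ Finset.range (2 * n)

open Classical in
/-- The matching generating function of the Aztec diamond of order `n` in terms of unit squares. -/
noncomputable def diamondSum (n : ℕ) (b : Prop) (W : ℕ → ℕ → ℝ) : ℝ :=
  ∑ S ∈ (diamondSquares n).powerset with DiamondValid n b S, ∏ p ∈ S, W p.1 p.2

/-- The part of a set of unit squares in each of the cells. -/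
def cellParts (n : ℕ) (S : Finset (ℕ × ℕ)) (c : Fin n × Fin n) : Finset (Fin 2 × Fin 2) :=
  {e | (2 * (c.1 : ℕ) + e.1, 2 * (c.2 : ℕ) + e.2) ∈ S}

/-- The unit square at a given position of a given cell. -/
def cellSquare {n : ℕ} (q : (Fin n × Fin n) × (Fin 2 × Fin 2)) : ℕ × ℕ :=
  (2 * (q.1.1 : ℕ) + q.2.1, 2 * (q.1.2 : ℕ) + q.2.2)

theorem cellSquare_injective {n : ℕ} : Function.Injective (cellSquare (n := n)) := by
  rintro ⟨⟨i, j⟩, ⟨α, β⟩⟩ ⟨⟨i', j'⟩, ⟨α', β'⟩⟩ h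
  simp only [cellSquare, Prod.mk.injEq] at h
  simp only [Prod.mk.injEq, Fin.ext_iff]
  omega

theorem exists_cellSquare_eq {n : ℕ} {p : ℕ × ℕ} (hp : p ∈ diamondSquares n) :
    ∃ q : (Fin n × Fin n) × (Fin 2 × Fin 2), cellSquare q = p := by
  simp only [diamondSquares, Finset.mem_product, Finset.mem_range] at hp
  refine ⟨((⟨p.1 / 2, by omega⟩, ⟨p.2 / 2, by omega⟩),
    (⟨p.1 % 2, by omega⟩, ⟨p.2 % 2, by omega⟩)), ?_⟩
  ext <;> simp only [cellSquare] <;> omega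

theorem cellSquare_mem {n : ℕ} (q : (Fin n × Fin n) × (Fin 2 × Fin 2)) :
    cellSquare q ∈ diamondSquares n := by
  simp only [diamondSquares, cellSquare, Finset.mem_product, Finset.mem_range]
  omega

theorem diamondValid_iff_cells {n : ℕ} (hn : 0 < n) {b : Prop} {S : Finset (ℕ × ℕ)}
    (hS : S ⊆ diamondSquares n) :
    DiamondValid n b S ↔ (∀ c, IsCellMatching (cellParts n S c)) ∧
      RowCompatible b (fun c => (cellCover (cellParts n S c)).1) ∧
      RowCompatible b (fun c => (cellCover (cellParts n S c.swap)).2) := by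
  have hb (r s) (h : (r, s) ∈ S) : r < 2 * n ∧ s < 2 * n := by
    simpa [diamondSquares] using hS h
  -- The vertices in odd rows are treated by transposing: both the position of the cell and the
  -- position of the edge in it are swapped.
  rw [DiamondValid, rowValid_iff_cells hn hb (cellParts n S) (by simp [cellParts]),
    rowValid_iff_cells hn (fun r s h => (hb s r h).symm)
      (fun c => (cellParts n S c.swap).image Prod.swap) (by simp [cellParts])]
  have h1 (c) : ((cellParts n S c).image Prod.swap).image Prod.fst =
      (cellParts n S c).image Prod.snd := by
    rw [Finset.image_image]; rfl
  have h2 (c) : ((cellParts n S c).image Prod.swap).card = (cellParts n S c).card :=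
    Finset.card_image_of_injective _ Prod.swap_injective
  simp only [h1, h2, IsCellMatching, forall_and, cellCover]
  have h3 : (∀ c : Fin n × Fin n, ((cellParts n S c.swap).image Prod.snd).card =
      (cellParts n S c.swap).card) ↔ ∀ c, ((cellParts n S c).image Prod.snd).card =
      (cellParts n S c).card :=
    ⟨fun h c => by simpa using h c.swap, fun h c => h _⟩
  rw [h3]
  tauto

open Classical in
-- Every unit square lies in exactly one cell, so cutting a set of squares into its cell parts is a
-- bijection under which weights multiply. This is the form to which `sum_cellMatching_compl`
-- applies.
theorem diamondSum_eq_cells {n : ℕ} (hn : 0 < n) (b : Prop) (W : ℕ → ℕ → ℝ) :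
    diamondSum n b W = ∑ s : Fin n × Fin n → Finset (Fin 2 × Fin 2) with
      (∀ c, IsCellMatching (s c)) ∧ RowCompatible b (fun c => (cellCover (s c)).1) ∧
        RowCompatible b (fun c => (cellCover (s c.swap)).2),
      ∏ c, ∏ e ∈ s c, W (2 * c.1 + e.1) (2 * c.2 + e.2) := by
  have hglue (s : Fin n × Fin n → Finset (Fin 2 × Fin 2)) :
      cellParts n ((Finset.univ.sigma s).image
        (fun q => cellSquare (q.1, q.2))) = s := by
    ext c e
    simp only [cellParts, Finset.mem_filter, Finset.mem_univ, true_and, Finset.mem_image,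
      Finset.mem_sigma]
    constructor
    · rintro ⟨⟨c', e'⟩, h, h'⟩
      have : (c', e') = (c, e) := cellSquare_injective h'
      simp only [Prod.mk.injEq] at this
      obtain ⟨rfl, rfl⟩ := this
      exact h
    · exact fun h => ⟨⟨c, e⟩, h, rfl⟩
  have hsub (s : Fin n × Fin n → Finset (Fin 2 × Fin 2)) :
      (Finset.univ.sigma s).image (fun q => cellSquare (q.1, q.2)) ⊆ diamondSquares n := by
    intro p hp
    obtain ⟨q, -, rfl⟩ := Finset.mem_image.1 hp
    exact cellSquare_mem _
  have hparts (S : Finset (ℕ × ℕ)) (hS : S ⊆ diamondSquares n) :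
      (Finset.univ.sigma (cellParts n S)).image (fun q => cellSquare (q.1, q.2)) = S := by
    ext p
    simp only [Finset.mem_image, Finset.mem_sigma, Finset.mem_univ, true_and, cellParts,
      Finset.mem_filter]
    constructor
    · rintro ⟨q, h, rfl⟩; exact h
    · intro hp
      obtain ⟨⟨c, e⟩, rfl⟩ := exists_cellSquare_eq (hS hp)
      exact ⟨⟨c, e⟩, hp, rfl⟩
  refine Finset.sum_bij' (fun S _ => cellParts n S)
    (fun s _ => (Finset.univ.sigma s).image (fun q => cellSquare (q.1, q.2))) ?_ ?_ ?_ ?_ ?_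
  · intro S hS
    simp only [Finset.mem_filter, Finset.mem_powerset, Finset.mem_univ, true_and] at hS ⊢
    exact (diamondValid_iff_cells hn hS.1).1 hS.2
  · intro s hs
    simp only [Finset.mem_filter, Finset.mem_powerset, Finset.mem_univ, true_and] at hs ⊢
    refine ⟨hsub s, (diamondValid_iff_cells hn (hsub s)).2 ?_⟩
    rw [hglue]; exact hs
  · intro S hS
    exact hparts S (by simpa using (Finset.mem_filter.1 hS).1)
  · intro s _; exact hglue s
  · intro S hS
    have hS' : S ⊆ diamondSquares n := by simpa using (Finset.mem_filter.1 hS).1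
    conv_lhs => rw [← hparts S hS']
    rw [Finset.prod_image, Finset.prod_sigma]
    · rfl
    · rintro ⟨c, e⟩ - ⟨c', e'⟩ - h
      have : (c, e) = (c', e') := cellSquare_injective h
      simp only [Prod.mk.injEq] at this
      obtain ⟨rfl, rfl⟩ := this
      rfl

/-! ### Reduction of the order by one. -/

/-- The weight of the perfect matchings of the cell `(i, j)`. -/
def cellDelta (W : ℕ → ℕ → ℝ) (i j : ℕ) : ℝ :=
  W (2 * i) (2 * j) * W (2 * i + 1) (2 * j + 1) + W (2 * i) (2 * j + 1) * W (2 * i + 1) (2 * j)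

/-- The weights after urban renewal in all cells. -/
noncomputable def flipWeight (W : ℕ → ℕ → ℝ) (r s : ℕ) : ℝ :=
  W (2 * (r / 2) + (1 - r % 2)) (2 * (s / 2) + (1 - s % 2)) / cellDelta W (r / 2) (s / 2)

theorem diamondSum_flip {n : ℕ} (hn : 0 < n) (W : ℕ → ℕ → ℝ)
    (hW : ∀ i < n, ∀ j < n, cellDelta W i j ≠ 0) :
    diamondSum n True W =
      (∏ i ∈ Finset.range n, ∏ j ∈ Finset.range n, cellDelta W i j) *
        diamondSum n False (flipWeight W) := by
  classical
  let w (c : Fin n × Fin n) (e : Fin 2 × Fin 2) : ℝ := W (2 * c.1 + e.1) (2 * c.2 + e.2)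
  have hdet (c) : cellDet (w c) = cellDelta W c.1 c.2 := by simp [cellDet, cellDelta, w]
  have key := sum_cellMatching_compl w (fun c => by rw [hdet]; exact hW _ c.1.2 _ c.2.2)
    (fun κ => RowCompatible True (fun c => (κ c).1) ∧ RowCompatible True (fun c => (κ c.swap).2))
  rw [diamondSum_eq_cells hn, diamondSum_eq_cells hn]
  refine Eq.trans ?_ (key.trans (congrArg₂ _ ?_ ?_))
  · exact Finset.sum_congr (by congr) fun _ _ => rfl
  · simp only [hdet]
    rw [Fintype.prod_prod_type, ← Fin.prod_univ_eq_prod_range (fun i => ∏ j ∈ Finset.range n, _)]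
    exact Finset.prod_congr rfl fun i _ => Fin.prod_univ_eq_prod_range (cellDelta W i) n
  · refine Finset.sum_congr ?_ fun s _ => Finset.prod_congr rfl fun c _ =>
      Finset.prod_congr rfl fun e _ => ?_
    · ext s
      simp only [Finset.mem_filter, Finset.mem_univ, true_and]
      refine and_congr_right fun _ => and_congr ?_ ?_
      · exact rowCompatible_compl.trans (by rw [not_true])
      · exact rowCompatible_compl.trans (by rw [not_true])
    · rw [cellFlip, hdet, flipWeight]
      obtain ⟨⟨i, hi⟩, ⟨j, hj⟩⟩ := c
      obtain ⟨α, β⟩ := e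
      have e0 (k : ℕ) : (2 * k + 1) / 2 = k := by omega
      have e1 (k : ℕ) : (2 * k + 1) % 2 = 1 := by omega
      fin_cases α <;> fin_cases β <;> simp [w, e0, e1]

/-- Translation by `(-1, -1)` carries the inner vertices in even rows to the vertices in odd rows of
the smaller diamond. The two vertex classes change roles, whence the transposed arguments on the
right. -/
theorem rowValid_succ_false {n : ℕ} {m : ℕ → ℕ → Prop}
    (hm : ∀ r s, m r s → 0 < r ∧ 0 < s ∧ r ≤ 2 * n ∧ s ≤ 2 * n) :
    RowValid (n + 1) False m ↔ RowValid n True (fun r s => m (s + 1) (r + 1)) := by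
  have hpred (r s) (h : m r s) : m (r - 1 + 1) (s - 1 + 1) := by
    have := hm _ _ h
    rwa [Nat.sub_add_cancel (by omega), Nat.sub_add_cancel (by omega)]
  constructor
  · rintro ⟨hinj, hcov⟩
    refine ⟨fun r s r' s' h h' hr hs => ?_, fun i hi j hj => ⟨fun _ => Or.inl trivial, fun _ => ?_⟩⟩
    · have := hinj _ _ _ _ h h' (by omega) (by omega)
      omega
    · obtain ⟨r, s, h, hr, hs⟩ := (hcov (j + 1) (by omega) i (by omega)).2 (Or.inr (by omega))
      have := hm _ _ h
      exact ⟨s - 1, r - 1, hpred _ _ h, by omega, by omega⟩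
  · rintro ⟨hinj, hcov⟩
    refine ⟨fun r s r' s' h h' hr hs => ?_, fun i hi j hj => ⟨?_, ?_⟩⟩
    · have b := hm _ _ h
      have b' := hm _ _ h'
      have := hinj (s - 1) (r - 1) (s' - 1) (r' - 1) (hpred _ _ h) (hpred _ _ h')
        (by omega) (by omega)
      omega
    · rintro ⟨r, s, h, hr, hs⟩
      have := hm _ _ h
      exact Or.inr (by omega)
    · rintro (h | h)
      · exact h.elim
      · obtain ⟨r, s, h, hr, hs⟩ := (hcov j (by omega) (i - 1) (by omega)).2 (Or.inl trivial)
        exact ⟨s + 1, r + 1, h, by omega, by omega⟩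

theorem RowValid.pos_of_false {n : ℕ} {m : ℕ → ℕ → Prop} (h : RowValid (n + 1) False m) {r s : ℕ}
    (hrs : m r s) (hr : r < 2 * (n + 1)) (hs : s < 2 * (n + 1)) : 0 < r ∧ r ≤ 2 * n := by
  have := (h.2 ((r + 1) / 2) (by omega) (s / 2) (by omega)).1 ⟨r, s, hrs, rfl, rfl⟩
  simp only [false_or] at this
  omega

theorem diamondSum_succ_false (n : ℕ) (W : ℕ → ℕ → ℝ) :
    diamondSum (n + 1) False W = diamondSum n True (fun r s => W (r + 1) (s + 1)) := by
  classical
  let f : ℕ × ℕ → ℕ × ℕ := fun p => (p.1 + 1, p.2 + 1)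
  have hf : Function.Injective f := by
    rintro ⟨a, b⟩ ⟨c, d⟩ h
    simpa [f] using h
  have hmem (S : Finset (ℕ × ℕ)) (r s : ℕ) : (r + 1, s + 1) ∈ S.image f ↔ (r, s) ∈ S :=
    hf.mem_finset_image (a := (r, s))
  have hvalid (S : Finset (ℕ × ℕ)) (hS : S ⊆ diamondSquares n) :
      DiamondValid (n + 1) False (S.image f) ↔ DiamondValid n True S := by
    have hb (p) (hp : p ∈ S.image f) : 0 < p.1 ∧ 0 < p.2 ∧ p.1 ≤ 2 * n ∧ p.2 ≤ 2 * n := by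
      obtain ⟨q, hq, rfl⟩ := Finset.mem_image.1 hp
      have := hS hq
      simp only [diamondSquares, Finset.mem_product, Finset.mem_range] at this
      simp only [f]; omega
    rw [DiamondValid, DiamondValid, rowValid_succ_false (fun r s h => hb _ h),
      rowValid_succ_false (fun r s h => by have := hb _ h; omega)]
    simp only [hmem]
    exact and_comm
  symm
  refine Finset.sum_bij (fun S _ => S.image f) ?_ ?_ ?_ ?_
  · intro S hS
    simp only [Finset.mem_filter, Finset.mem_powerset] at hS ⊢
    refine ⟨?_, (hvalid S hS.1).2 hS.2⟩
    intro p hp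
    obtain ⟨q, hq, rfl⟩ := Finset.mem_image.1 hp
    have := hS.1 hq
    simp only [diamondSquares, Finset.mem_product, Finset.mem_range, f] at this ⊢
    omega
  · intro S _ S' _ h
    exact Finset.image_injective hf h
  · intro S hS
    simp only [Finset.mem_filter, Finset.mem_powerset] at hS
    obtain ⟨hS, hv⟩ := hS
    have hb (p) (hp : p ∈ S) : p.1 < 2 * (n + 1) ∧ p.2 < 2 * (n + 1) := by
      simpa [diamondSquares] using hS hp
    have hpos (p) (hp : p ∈ S) : 0 < p.1 ∧ p.1 ≤ 2 * n ∧ 0 < p.2 ∧ p.2 ≤ 2 * n := by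
      have h1 := hv.1.pos_of_false hp (hb p hp).1 (hb p hp).2
      have h2 := hv.2.pos_of_false (r := p.2) (s := p.1) hp (hb p hp).2 (hb p hp).1
      exact ⟨h1.1, h1.2, h2.1, h2.2⟩
    have hpre : (S.preimage f hf.injOn).image f = S := by
      rw [Finset.image_preimage, Finset.filter_true_of_mem]
      intro p hp
      have := hpos p hp
      exact ⟨(p.1 - 1, p.2 - 1), by simp only [f]; ext <;> simp only <;> omega⟩
    have hsub : S.preimage f hf.injOn ⊆ diamondSquares n := by
      intro p hp
      have := hpos _ (Finset.mem_preimage.1 hp)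
      simp only [diamondSquares, Finset.mem_product, Finset.mem_range, f] at this ⊢
      omega
    refine ⟨S.preimage f hf.injOn, ?_, hpre⟩
    simp only [Finset.mem_filter, Finset.mem_powerset]
    exact ⟨hsub, (hvalid _ hsub).1 (by rwa [hpre])⟩
  · intro S _
    rw [Finset.prod_image fun _ _ _ _ h => hf h]

/-- Sending an edge to its endpoint in an even row is a bijection from a perfect matching onto all
such vertices. -/
theorem RowValid.prod_eq {n : ℕ} {S : Finset (ℕ × ℕ)} (hS : S ⊆ diamondSquares n)
    (h : RowValid n True (fun r s => (r, s) ∈ S)) (g : ℕ → ℕ → ℝ) :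
    ∏ p ∈ S, g ((p.1 + 1) / 2) (p.2 / 2) =
      ∏ i ∈ Finset.range (n + 1), ∏ j ∈ Finset.range n, g i j := by
  rw [← Finset.prod_product' (f := g)]
  refine Finset.prod_bij (fun p _ => ((p.1 + 1) / 2, p.2 / 2)) ?_ ?_ ?_ fun _ _ => rfl
  · intro p hp
    have := hS hp
    simp only [diamondSquares, Finset.mem_product, Finset.mem_range] at this ⊢
    omega
  · intro p hp q hq hpq
    simp only [Prod.mk.injEq] at hpq
    exact Prod.ext_iff.2 (h.1 _ _ _ _ hp hq hpq.1 hpq.2)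
  · rintro ⟨i, j⟩ hij
    simp only [Finset.mem_product, Finset.mem_range] at hij
    obtain ⟨r, s, hrs, rfl, rfl⟩ := (h.2 i (by omega) j hij.2).2 (Or.inl trivial)
    exact ⟨(r, s), hrs, rfl⟩

/-- The factor `g i j` sits at the vertex `(2i, 2j + 1)` and `h i j` at `(2i + 1, 2j)`. Each
matching meets each vertex once, so every term acquires the same factor. -/
theorem diamondSum_gauge (n : ℕ) (W : ℕ → ℕ → ℝ) (g h : ℕ → ℕ → ℝ) :
    diamondSum n True (fun r s => g ((r + 1) / 2) (s / 2) * h (r / 2) ((s + 1) / 2) * W r s) =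
      (∏ i ∈ Finset.range (n + 1), ∏ j ∈ Finset.range n, g i j) *
        (∏ i ∈ Finset.range n, ∏ j ∈ Finset.range (n + 1), h i j) * diamondSum n True W := by
  classical
  rw [diamondSum, diamondSum, Finset.mul_sum]
  refine Finset.sum_congr rfl fun S hS => ?_
  simp only [Finset.mem_filter, Finset.mem_powerset] at hS
  obtain ⟨hS, h1, h2⟩ := hS
  rw [Finset.prod_mul_distrib, Finset.prod_mul_distrib, h1.prod_eq hS]
  congr 2
  have hS' : S.image Prod.swap ⊆ diamondSquares n := by
    intro p hp
    obtain ⟨q, hq, rfl⟩ := Finset.mem_image.1 hp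
    have := hS hq
    simp only [diamondSquares, Finset.mem_product, Finset.mem_range, Prod.fst_swap,
      Prod.snd_swap] at this ⊢
    exact this.symm
  have := RowValid.prod_eq hS' ((RowValid.congr fun r s => by simp).1 h2) (fun i j => h j i)
  rw [Finset.prod_image Prod.swap_injective.injOn] at this
  simp only [Prod.fst_swap, Prod.snd_swap] at this
  rw [this, Finset.prod_comm]

theorem diamondSum_congr {n : ℕ} {b : Prop} {W W' : ℕ → ℕ → ℝ}
    (h : ∀ r s, W r s = W' r s) : diamondSum n b W = diamondSum n b W' := by
  have : W = W' := by ext r s; exact h r s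
  rw [this]

theorem diamondSum_zero (W : ℕ → ℕ → ℝ) : diamondSum 0 True W = 1 := by
  classical
  have : DiamondValid 0 True ∅ := by simp [DiamondValid, RowValid]
  simp [diamondSum, diamondSquares, Finset.sum_filter, this]

/-- The reduction of the Aztec diamond of order `n + 1` to that of order `n`: urban renewal in all
cells, followed by a change of weights at the vertices. -/
theorem diamondSum_succ {n : ℕ} {W W' g h : ℕ → ℕ → ℝ}
    (hW : ∀ i j, cellDelta W i j ≠ 0)
    (hW' : ∀ r s, W' r s =
      g ((r + 1) / 2) (s / 2) * h (r / 2) ((s + 1) / 2) * flipWeight W (r + 1) (s + 1)) :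
    ((∏ i ∈ Finset.range (n + 1), ∏ j ∈ Finset.range n, g i j) *
        ∏ i ∈ Finset.range n, ∏ j ∈ Finset.range (n + 1), h i j) * diamondSum (n + 1) True W =
      (∏ i ∈ Finset.range (n + 1), ∏ j ∈ Finset.range (n + 1), cellDelta W i j) *
        diamondSum n True W' := by
  rw [diamondSum_flip n.succ_pos W fun i _ j _ => hW i j, diamondSum_succ_false,
    diamondSum_congr hW', diamondSum_gauge]
  ring

/-! ### From subgraphs to sets of unit squares. -/

/-- The unit square in which an edge of the Aztec diamond graph lies. -/
def edgeSquare {n : ℕ} : Sym2 (AztecVertex n) → ℕ × ℕ :=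
  Sym2.lift ⟨fun u v => (min (u.1.1 : ℕ) v.1.1, min (u.1.2 : ℕ) v.1.2), fun u v => by
    simp only [min_comm]⟩

theorem edgeSquare_mk {n : ℕ} (u v : AztecVertex n) :
    edgeSquare s(u, v) = (min (u.1.1 : ℕ) v.1.1, min (u.1.2 : ℕ) v.1.2) := rfl

theorem aztecWeight_eq (n : ℕ) (W : ℕ → ℕ → ℝ) (e : Sym2 (AztecVertex n)) :
    aztecWeight n W e = W (edgeSquare e).1 (edgeSquare e).2 := by
  induction e with | _ u v => rfl

theorem AztecVertex.ext_val {n : ℕ} {u v : AztecVertex n} (h1 : (u.1.1 : ℕ) = v.1.1)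
    (h2 : (u.1.2 : ℕ) = v.1.2) : u = v :=
  Subtype.ext (Prod.ext (Fin.ext h1) (Fin.ext h2))

theorem AztecVertex.mod_two {n : ℕ} (u : AztecVertex n) :
    ((u.1.1 : ℕ) + u.1.2) % 2 = 1 := Nat.odd_iff.1 u.2

/-- Only two corners of a unit square have odd coordinate sum, and their rows have different parity.
Naming the endpoint in the even row first makes both endpoints functions of the square. -/
theorem aztecGraph_adj_coords {n : ℕ} {u v : AztecVertex n} (h : (aztecGraph n).Adj u v)
    (hu : (u.1.1 : ℕ) % 2 = 0) {r s : ℕ} (hrs : edgeSquare s(u, v) = (r, s)) :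
    (r < 2 * n ∧ s < 2 * n) ∧ ((u.1.1 : ℕ) = 2 * ((r + 1) / 2) ∧ (u.1.2 : ℕ) = 2 * (s / 2) + 1) ∧
      (v.1.1 : ℕ) = 2 * (r / 2) + 1 ∧ (v.1.2 : ℕ) = 2 * ((s + 1) / 2) := by
  have h1 := u.mod_two
  have h2 := v.mod_two
  have h3 := u.1.1.2
  have h4 := u.1.2.2
  have h5 := v.1.1.2
  have h6 := v.1.2.2
  simp only [edgeSquare_mk, Prod.mk.injEq] at hrs
  simp only [aztecGraph] at h
  omega

theorem exists_aztecGraph_adj {n r s : ℕ} (hr : r < 2 * n) (hs : s < 2 * n) :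
    ∃ u v : AztecVertex n, (aztecGraph n).Adj u v ∧ (u.1.1 : ℕ) % 2 = 0 ∧
      edgeSquare s(u, v) = (r, s) := by
  refine ⟨⟨(⟨2 * ((r + 1) / 2), by omega⟩, ⟨2 * (s / 2) + 1, by omega⟩), ?_⟩,
    ⟨(⟨2 * (r / 2) + 1, by omega⟩, ⟨2 * ((s + 1) / 2), by omega⟩), ?_⟩, ?_, ?_, ?_⟩
  · rw [Nat.odd_iff]; simp only; omega
  · rw [Nat.odd_iff]; simp only; omega
  · simp only [aztecGraph]; omega
  · simp only; omega
  · simp only [edgeSquare_mk, Prod.mk.injEq]; omega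

/-- The relation `A` is left general so as to cover both the graph and its subgraphs. -/
theorem exists_even_of_adj {n : ℕ} {A : AztecVertex n → AztecVertex n → Prop}
    (hA : ∀ u v, A u v → (aztecGraph n).Adj u v) (hsymm : ∀ u v, A u v → A v u)
    {u v : AztecVertex n} (h : A u v) :
    ∃ u' v', A u' v' ∧ (u'.1.1 : ℕ) % 2 = 0 ∧ s(u', v') = s(u, v) := by
  by_cases hu : (u.1.1 : ℕ) % 2 = 0
  · exact ⟨u, v, h, hu, rfl⟩
  · refine ⟨v, u, hsymm _ _ h, ?_, Sym2.eq_swap⟩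
    have := hA _ _ h
    simp only [aztecGraph] at this
    omega

theorem edgeSquare_injOn {n : ℕ} {u v u' v' : AztecVertex n} (h : (aztecGraph n).Adj u v)
    (h' : (aztecGraph n).Adj u' v') (heq : edgeSquare s(u, v) = edgeSquare s(u', v')) :
    s(u, v) = s(u', v') := by
  obtain ⟨a, b, hab, ha, e⟩ := exists_even_of_adj (A := (aztecGraph n).Adj) (fun _ _ h => h)
    (fun _ _ h => h.symm) h
  obtain ⟨a', b', hab', ha', e'⟩ := exists_even_of_adj (A := (aztecGraph n).Adj) (fun _ _ h => h)
    (fun _ _ h => h.symm) h'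
  rw [← e, ← e'] at heq ⊢
  have c := aztecGraph_adj_coords hab ha rfl
  have c' := aztecGraph_adj_coords hab' ha' heq.symm
  rw [AztecVertex.ext_val (u := a) (v := a') (by omega) (by omega),
    AztecVertex.ext_val (u := b) (v := b') (by omega) (by omega)]

open Classical in
/-- The unit squares containing the edges of a subgraph of the Aztec diamond graph. -/
noncomputable def subgraphSquares {n : ℕ} (M : (aztecGraph n).Subgraph) : Finset (ℕ × ℕ) :=
  M.edgeSet.toFinset.image edgeSquare

theorem mem_subgraphSquares {n : ℕ} {M : (aztecGraph n).Subgraph} {p : ℕ × ℕ} :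
    p ∈ subgraphSquares M ↔
      ∃ u v, M.Adj u v ∧ (u.1.1 : ℕ) % 2 = 0 ∧ edgeSquare s(u, v) = p := by
  simp only [subgraphSquares, Finset.mem_image, Set.mem_toFinset]
  constructor
  · rintro ⟨e, he, rfl⟩
    induction e with | _ u v =>
    obtain ⟨a, b, hab, ha, e⟩ := exists_even_of_adj (A := M.Adj) (fun _ _ h => h.adj_sub)
      (fun _ _ h => h.symm) he
    exact ⟨a, b, hab, ha, by rw [e]⟩
  · rintro ⟨u, v, h, -, rfl⟩
    exact ⟨s(u, v), h, rfl⟩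

theorem adj_iff_mem_subgraphSquares {n : ℕ} {M : (aztecGraph n).Subgraph} {u v : AztecVertex n} :
    M.Adj u v ↔ (aztecGraph n).Adj u v ∧ edgeSquare s(u, v) ∈ subgraphSquares M := by
  constructor
  · intro h
    refine ⟨h.adj_sub, ?_⟩
    simp only [subgraphSquares, Finset.mem_image, Set.mem_toFinset]
    exact ⟨s(u, v), h, rfl⟩
  · rintro ⟨h, hm⟩
    obtain ⟨u', v', h', -, he⟩ := mem_subgraphSquares.1 hm
    have := edgeSquare_injOn h'.adj_sub h he
    rw [← SimpleGraph.Subgraph.mem_edgeSet, ← this]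
    exact h'

theorem subgraphSquares_subset {n : ℕ} (M : (aztecGraph n).Subgraph) :
    subgraphSquares M ⊆ diamondSquares n := by
  rintro ⟨r, s⟩ hp
  obtain ⟨u, v, h, hu, e⟩ := mem_subgraphSquares.1 hp
  simpa [diamondSquares] using (aztecGraph_adj_coords h.adj_sub hu e).1

/-- The two halves of `DiamondValid` express exact covering of the vertices in even rows and, with
coordinates exchanged, of those in odd rows. -/
theorem isPerfectMatching_iff_diamondValid {n : ℕ} {M : (aztecGraph n).Subgraph} :
    M.IsPerfectMatching ↔ DiamondValid n True (subgraphSquares M) := by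
  rw [SimpleGraph.Subgraph.isPerfectMatching_iff]
  constructor
  · intro h
    refine ⟨⟨?_, fun i hi j hj => ⟨fun _ => Or.inl trivial, fun _ => ?_⟩⟩,
      ⟨?_, fun i hi j hj => ⟨fun _ => Or.inl trivial, fun _ => ?_⟩⟩⟩
    · intro r s r' s' hp hp' hr hs
      obtain ⟨u, v, a, hu, e⟩ := mem_subgraphSquares.1 hp
      obtain ⟨u', v', a', hu', e'⟩ := mem_subgraphSquares.1 hp'
      have c := aztecGraph_adj_coords a.adj_sub hu e
      have c' := aztecGraph_adj_coords a'.adj_sub hu' e'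
      obtain rfl : u = u' := AztecVertex.ext_val (by omega) (by omega)
      obtain rfl : v = v' := (h u).unique a a'
      simpa using e.symm.trans e'
    · let u : AztecVertex n := ⟨(⟨2 * i, by omega⟩, ⟨2 * j + 1, by omega⟩), by
        rw [Nat.odd_iff]; simp only; omega⟩
      obtain ⟨v, a, -⟩ := h u
      have c := aztecGraph_adj_coords a.adj_sub (by simp [u]) rfl
      refine ⟨_, _, mem_subgraphSquares.2 ⟨u, v, a, by simp [u], rfl⟩, ?_, ?_⟩
      · have : (u.1.1 : ℕ) = 2 * i := rfl
        omega
      · have : (u.1.2 : ℕ) = 2 * j + 1 := rfl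
        omega
    · intro s r s' r' hp hp' hs hr
      obtain ⟨u, v, a, hu, e⟩ := mem_subgraphSquares.1 hp
      obtain ⟨u', v', a', hu', e'⟩ := mem_subgraphSquares.1 hp'
      have c := aztecGraph_adj_coords a.adj_sub hu e
      have c' := aztecGraph_adj_coords a'.adj_sub hu' e'
      obtain rfl : v = v' := AztecVertex.ext_val (by omega) (by omega)
      obtain rfl : u = u' := (h v).unique a.symm a'.symm
      have := e.symm.trans e'
      simp only [Prod.mk.injEq] at this
      exact this.symm
    · let v : AztecVertex n := ⟨(⟨2 * j + 1, by omega⟩, ⟨2 * i, by omega⟩), by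
        rw [Nat.odd_iff]; simp only; omega⟩
      obtain ⟨u, a, -⟩ := h v
      have h1 : (v.1.1 : ℕ) = 2 * j + 1 := rfl
      have h2 : (v.1.2 : ℕ) = 2 * i := rfl
      have hu : (u.1.1 : ℕ) % 2 = 0 := by
        have := a.adj_sub
        simp only [aztecGraph] at this
        omega
      have c := aztecGraph_adj_coords a.symm.adj_sub hu rfl
      exact ⟨_, _, mem_subgraphSquares.2 ⟨u, v, a.symm, hu, rfl⟩, by omega, by omega⟩
  · rintro ⟨⟨hT, hT'⟩, ⟨hL, hL'⟩⟩ v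
    have hv := v.mod_two
    have b1 := v.1.1.2
    have b2 := v.1.2.2
    by_cases hpar : (v.1.1 : ℕ) % 2 = 0
    · obtain ⟨r, s, hp, hr, hs⟩ :=
        (hT' ((v.1.1 : ℕ) / 2) (by omega) ((v.1.2 : ℕ) / 2) (by omega)).2 (Or.inl trivial)
      obtain ⟨u, w, a, hu, e⟩ := mem_subgraphSquares.1 hp
      have c := aztecGraph_adj_coords a.adj_sub hu e
      obtain rfl : u = v := AztecVertex.ext_val (by omega) (by omega)
      refine ⟨w, a, fun w' a' => ?_⟩
      have hp' := (adj_iff_mem_subgraphSquares.1 a').2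
      have c' := aztecGraph_adj_coords a'.adj_sub hu rfl
      have := hT _ _ _ _ hp hp' (by omega) (by omega)
      exact AztecVertex.ext_val (by omega) (by omega)
    · obtain ⟨s, r, hp, hs, hr⟩ :=
        (hL' ((v.1.2 : ℕ) / 2) (by omega) ((v.1.1 : ℕ) / 2) (by omega)).2 (Or.inl trivial)
      obtain ⟨u, w, a, hu, e⟩ := mem_subgraphSquares.1 hp
      have c := aztecGraph_adj_coords a.adj_sub hu e
      obtain rfl : w = v := AztecVertex.ext_val (by omega) (by omega)
      refine ⟨u, a.symm, fun u' a' => ?_⟩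
      have hu' : (u'.1.1 : ℕ) % 2 = 0 := by
        have := a'.adj_sub
        simp only [aztecGraph] at this
        omega
      have hp' := (adj_iff_mem_subgraphSquares.1 a'.symm).2
      have c' := aztecGraph_adj_coords a'.symm.adj_sub hu' rfl
      have := hL _ _ _ _ hp hp' (by omega) (by omega)
      exact AztecVertex.ext_val (by omega) (by omega)

open Classical in
theorem prod_subgraphSquares {n : ℕ} (M : (aztecGraph n).Subgraph) (W : ℕ → ℕ → ℝ) :
    ∏ p ∈ subgraphSquares M, W p.1 p.2 =
      ∏ e ∈ M.edgeSet.toFinset, W (edgeSquare e).1 (edgeSquare e).2 := by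
  rw [subgraphSquares, Finset.prod_image]
  intro e he e' he' h
  rw [Finset.mem_coe, Set.mem_toFinset] at he he'
  induction e with | _ u v =>
  induction e' with | _ u' v' =>
  exact edgeSquare_injOn (SimpleGraph.Subgraph.Adj.adj_sub he)
    (SimpleGraph.Subgraph.Adj.adj_sub he') h

theorem exists_subgraphSquares_eq {n : ℕ} {S : Finset (ℕ × ℕ)} (hS : S ⊆ diamondSquares n) :
    ∃ M : (aztecGraph n).Subgraph, subgraphSquares M = S := by
  let M : (aztecGraph n).Subgraph :=
    { verts := Set.univ
      Adj := fun u v => (aztecGraph n).Adj u v ∧ edgeSquare s(u, v) ∈ S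
      adj_sub := fun h => h.1
      edge_vert := fun _ => Set.mem_univ _
      symm := ⟨fun u v h => ⟨h.1.symm, by rw [Sym2.eq_swap]; exact h.2⟩⟩ }
  refine ⟨M, ?_⟩
  ext p
  rw [mem_subgraphSquares]
  constructor
  · rintro ⟨u, v, h, -, rfl⟩; exact h.2
  · intro hp
    have hb := hS hp
    simp only [diamondSquares, Finset.mem_product, Finset.mem_range] at hb
    obtain ⟨u, v, a, hu, e⟩ := exists_aztecGraph_adj hb.1 hb.2
    exact ⟨u, v, ⟨a, by rw [e]; exact hp⟩, hu, e⟩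

theorem sum_perfectMatching_eq_diamondSum (n : ℕ) (W : ℕ → ℕ → ℝ)
    [Fintype {M : (aztecGraph n).Subgraph // M.IsPerfectMatching}] :
    ∑ M : {M : (aztecGraph n).Subgraph // M.IsPerfectMatching},
      ∏ p ∈ subgraphSquares M.1, W p.1 p.2 = diamondSum n True W := by
  classical
  rw [diamondSum]
  refine Finset.sum_bij (fun M _ => subgraphSquares M.1) ?_ ?_ ?_ ?_
  · rintro ⟨M, hM⟩ -
    simp only [Finset.mem_filter, Finset.mem_powerset]
    exact ⟨subgraphSquares_subset M, isPerfectMatching_iff_diamondValid.1 hM⟩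
  · rintro ⟨M, hM⟩ - ⟨M', hM'⟩ - h
    refine Subtype.ext (SimpleGraph.Subgraph.ext ?_ ?_)
    -- The squares determine only the adjacency; the vertex sets agree because both matchings are
    -- spanning.
    · rw [Set.eq_univ_of_forall hM.2, Set.eq_univ_of_forall hM'.2]
    · ext u v
      simp only at h ⊢
      rw [adj_iff_mem_subgraphSquares, adj_iff_mem_subgraphSquares, h]
  · intro S hS
    simp only [Finset.mem_filter, Finset.mem_powerset] at hS
    obtain ⟨hS, hv⟩ := hS
    obtain ⟨M, hM⟩ := exists_subgraphSquares_eq hS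
    have hMv : M.IsPerfectMatching := isPerfectMatching_iff_diamondValid.2 (by rw [hM]; exact hv)
    exact ⟨⟨M, hMv⟩, Finset.mem_univ _, hM⟩
  · exact fun _ _ => rfl

/-- The definition uses classical finiteness instances; this frees the sum from that choice. -/
theorem matchingGenFun_eq {V : Type*} [Fintype V] (G : SimpleGraph V) (wt : Sym2 V → ℝ)
    [Fintype {M : G.Subgraph // M.IsPerfectMatching}]
    [∀ M : G.Subgraph, Fintype M.edgeSet] :
    matchingGenFun G wt = ∑ M : {M : G.Subgraph // M.IsPerfectMatching},
      ∏ e ∈ M.1.edgeSet.toFinset, wt e := by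
  rw [matchingGenFun]
  congr!

open Classical in
theorem matchingGenFun_aztecGraph (n : ℕ) (W : ℕ → ℕ → ℝ) :
    matchingGenFun (aztecGraph n) (aztecWeight n W) = diamondSum n True W := by
  rw [matchingGenFun_eq, ← sum_perfectMatching_eq_diamondSum]
  refine Fintype.sum_congr _ _ fun M => ?_
  rw [prod_subgraphSquares M.1 W]
  exact Finset.prod_congr rfl fun e _ => aztecWeight_eq n W e

/-! ### Products of periodic weights and their logarithms. -/

theorem periodicWeight_congr {k l : ℕ} [NeZero k] [NeZero l] (A : Matrix (Fin k) (Fin l) ℝ)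
    {i i' j j' : ℕ} (hi : i % k = i' % k) (hj : j % l = j' % l) :
    periodicWeight A i j = periodicWeight A i' j' := by
  have h1 : Fin.ofNat k i = Fin.ofNat k i' := Fin.ext hi
  have h2 : Fin.ofNat l j = Fin.ofNat l j' := Fin.ext hj
  rw [periodicWeight, periodicWeight, h1, h2]

/-- The sum of the entries in the first `m` rows and `n` columns of the periodic continuation of
`L`. -/
def periodicSum (L : Matrix (Fin 2) (Fin 4) ℝ) (m n : ℕ) : ℝ :=
  ∑ u : Fin 2, ∑ v : Fin 4,
    (((m + 1 - u) / 2 : ℕ) : ℝ) * (((n + 3 - v) / 4 : ℕ) : ℝ) * L u v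

/-- For sizes in a fixed residue class modulo 4 the rounded quotients become linear in `m`, so
`ring` can treat the sum as a polynomial in `m`. -/
theorem periodicSum_four_mul_add (L : Matrix (Fin 2) (Fin 4) ℝ) (m c c' : ℕ) :
    periodicSum L (4 * m + c) (4 * m + c') = ∑ u : Fin 2, ∑ v : Fin 4,
      (2 * m + ((c + 1 - u) / 2 : ℕ)) * (m + ((c' + 3 - v) / 4 : ℕ)) * L u v := by
  refine Finset.sum_congr rfl fun u _ => Finset.sum_congr rfl fun v _ => ?_
  rw [show (4 * m + c + 1 - u) / 2 = 2 * m + (c + 1 - u) / 2 by omega,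
    show (4 * m + c' + 3 - v) / 4 = m + (c' + 3 - v) / 4 by omega]
  push_cast
  rfl

theorem sum_range_two_periodic (f : Fin 2 → ℝ) (m : ℕ) :
    ∑ i ∈ Finset.range m, f (Fin.ofNat 2 i) = ∑ u : Fin 2, (((m + 1 - u) / 2 : ℕ) : ℝ) * f u := by
  induction m with
  | zero => simp [Fin.sum_univ_two]
  | succ m ih =>
    rw [Finset.sum_range_succ, ih, Fin.sum_univ_two, Fin.sum_univ_two]
    obtain ⟨k, rfl | rfl⟩ : ∃ k, m = 2 * k ∨ m = 2 * k + 1 := ⟨m / 2, by omega⟩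
    · have e : Fin.ofNat 2 (2 * k) = 0 := Fin.ext (by simp)
      simp only [e, Fin.val_zero, Fin.val_one]
      rw [show (2 * k + 1 + 1 - 0) / 2 = k + 1 by omega, show (2 * k + 1 - 0) / 2 = k by omega,
        show (2 * k + 1 + 1 - 1) / 2 = k by omega, show (2 * k + 1 - 1) / 2 = k by omega]
      push_cast; ring
    · have e : Fin.ofNat 2 (2 * k + 1) = 1 := Fin.ext (by simp)
      simp only [e, Fin.val_zero, Fin.val_one]
      rw [show (2 * k + 1 + 1 + 1 - 0) / 2 = k + 1 by omega,
        show (2 * k + 1 + 1 - 0) / 2 = k + 1 by omega,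
        show (2 * k + 1 + 1 + 1 - 1) / 2 = k + 1 by omega,
        show (2 * k + 1 + 1 - 1) / 2 = k by omega]
      push_cast; ring

theorem sum_range_four_periodic (f : Fin 4 → ℝ) (m : ℕ) :
    ∑ i ∈ Finset.range m, f (Fin.ofNat 4 i) = ∑ v : Fin 4, (((m + 3 - v) / 4 : ℕ) : ℝ) * f v := by
  induction m with
  | zero => simp [Fin.sum_univ_four]
  | succ m ih =>
    rw [Finset.sum_range_succ, ih]
    -- Passing from `m` to `m + 1` terms raises the count of exactly one residue class, that of `m`.
    have hstep (v : Fin 4) : (m + 1 + 3 - v) / 4 =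
        (m + 3 - v) / 4 + if v = Fin.ofNat 4 m then 1 else 0 := by
      have h : v = Fin.ofNat 4 m ↔ (v : ℕ) = m % 4 := Fin.ext_iff
      split_ifs with hv
      · rw [h] at hv; omega
      · rw [h] at hv; omega
    simp only [hstep, Nat.cast_add, add_mul, Finset.sum_add_distrib]
    simp

theorem log_prod_periodicWeight {D : Matrix (Fin 2) (Fin 4) ℝ} (hD : ∀ u v, 0 < D u v)
    (m n : ℕ) :
    0 < ∏ i ∈ Finset.range m, ∏ j ∈ Finset.range n, periodicWeight D i j ∧
    Real.log (∏ i ∈ Finset.range m, ∏ j ∈ Finset.range n, periodicWeight D i j) =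
      periodicSum (D.map Real.log) m n := by
  have hpos (i j : ℕ) : 0 < periodicWeight D i j := hD _ _
  refine ⟨Finset.prod_pos fun i _ => Finset.prod_pos fun j _ => hpos i j, ?_⟩
  rw [Real.log_prod (fun i _ => (Finset.prod_pos fun j _ => hpos i j).ne')]
  have (i : ℕ) : Real.log (∏ j ∈ Finset.range n, periodicWeight D i j) =
      ∑ v : Fin 4, (((n + 3 - v) / 4 : ℕ) : ℝ) * Real.log (D (Fin.ofNat 2 i) v) := by
    rw [Real.log_prod (fun j _ => (hpos i j).ne')]
    exact sum_range_four_periodic (fun v => Real.log (D (Fin.ofNat 2 i) v)) n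
  simp only [this]
  rw [sum_range_two_periodic
    (fun u => ∑ v : Fin 4, (((n + 3 - v) / 4 : ℕ) : ℝ) * Real.log (D u v))]
  simp only [periodicSum, Matrix.map_apply, Finset.mul_sum, mul_assoc]

/-- The pattern `A'` arises from the pattern `A` by urban renewal in all cells, where the cells of
`A`
have the weights `D`, and by multiplying the weights at the vertices by `g` and `h`. -/
structure IsRenewal (A A' : Matrix (Fin 4) (Fin 8) ℝ) (D g h : Matrix (Fin 2) (Fin 4) ℝ) :
    Prop where
  cell_pos : ∀ u v, 0 < D u v
  row_pos : ∀ u v, 0 < g u v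
  column_pos : ∀ u v, 0 < h u v
  cell_eq : ∀ i < 2, ∀ j < 4, cellDelta (periodicWeight A) i j = periodicWeight D i j
  weight_eq : ∀ r < 4, ∀ s < 8,
    periodicWeight A' r s * periodicWeight D ((r + 1) / 2) ((s + 1) / 2) =
      periodicWeight g ((r + 1) / 2) (s / 2) * periodicWeight h (r / 2) ((s + 1) / 2) *
        periodicWeight A (2 * ((r + 1) / 2) + (1 - (r + 1) % 2))
          (2 * ((s + 1) / 2) + (1 - (s + 1) % 2))

/-- Periodicity extends the checks on one period to all indices, after which this is the logarithm
of `diamondSum_succ`. Positivity is passed on as well, since the logarithms at the next order depend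
on it. -/
theorem IsRenewal.log_diamondSum {A A' : Matrix (Fin 4) (Fin 8) ℝ}
    {D g h : Matrix (Fin 2) (Fin 4) ℝ} (H : IsRenewal A A' D g h) {n : ℕ}
    (hn : 0 < diamondSum n True (periodicWeight A')) :
    0 < diamondSum (n + 1) True (periodicWeight A) ∧
    Real.log (diamondSum (n + 1) True (periodicWeight A)) =
      periodicSum (D.map Real.log) (n + 1) (n + 1) - periodicSum (g.map Real.log)
        (n + 1) n - periodicSum (h.map Real.log) n (n + 1) +
        Real.log (diamondSum n True (periodicWeight A')) := by
  have hcell (i j : ℕ) : cellDelta (periodicWeight A) i j = periodicWeight D i j := by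
    rw [periodicWeight_congr D (i' := i % 2) (j' := j % 4) (by omega) (by omega),
      ← H.cell_eq _ (Nat.mod_lt _ (by omega)) _ (Nat.mod_lt _ (by omega)), cellDelta, cellDelta]
    congr 2 <;> apply periodicWeight_congr <;> omega
  have hDpos (i j : ℕ) : 0 < periodicWeight D i j := H.cell_pos _ _
  have key := diamondSum_succ (n := n) (W := periodicWeight A) (W' := periodicWeight A')
    (g := periodicWeight g) (h := periodicWeight h) (fun i j => by rw [hcell]; exact
      (hDpos i j).ne')
    (fun r s => by
      rw [flipWeight, hcell, ← mul_div_assoc, eq_div_iff (hDpos _ _).ne']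
      have := H.weight_eq (r % 4) (Nat.mod_lt _ (by omega)) (s % 8) (Nat.mod_lt _ (by omega))
      convert this using 2
      · apply periodicWeight_congr <;> omega
      · apply periodicWeight_congr <;> omega
      · congr 1 <;> apply periodicWeight_congr <;> omega
      · apply periodicWeight_congr <;> omega)
  simp only [hcell] at key
  obtain ⟨pD, lD⟩ := log_prod_periodicWeight H.cell_pos (n + 1) (n + 1)
  obtain ⟨pg, lg⟩ := log_prod_periodicWeight H.row_pos (n + 1) n
  obtain ⟨ph, lh⟩ := log_prod_periodicWeight H.column_pos n (n + 1)
  have hpos : 0 < diamondSum (n + 1) True (periodicWeight A) :=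
    pos_of_mul_pos_right (key ▸ mul_pos pD hn) (mul_pos pg ph).le
  refine ⟨hpos, ?_⟩
  have := congrArg Real.log key
  rw [Real.log_mul (mul_pos pg ph).ne' hpos.ne', Real.log_mul pg.ne' ph.ne',
    Real.log_mul pD.ne' hn.ne', lD, lg, lh] at this
  linarith

/-! ### The cycle of eight weight patterns. -/

/-- The weight pattern `N` after 1 urban renewal, up to a change of weights at the vertices. -/
noncomputable def patternRenewed1 (a b c d x y z t p q : ℝ) : Matrix (Fin 4) (Fin 8) ℝ :=
  !![a * q, y * p, x * p, a * q, b * q, x * p, y * p, b * q;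
     t * p, c * q, d * q, t * p, z * p, d * q, c * q, z * p;
     x * p, b * q, a * q, x * p, y * p, a * q, b * q, y * p;
     d * q, z * p, t * p, d * q, c * q, t * p, z * p, c * q]

/-- The weight pattern `N` after 2 urban renewals, up to a change of weights at the vertices. -/
noncomputable def patternRenewed2 (a b c d x y z t p q r s : ℝ) : Matrix (Fin 4) (Fin 8) ℝ :=
  !![a * q * s, a * q, x * p, x * p * r, b * q * r, b * q, y * p, y * p * s;
     d * q * r, d * q, t * p, t * p * s, c * q * s, c * q, z * p, z * p * r;
     x * p * r, x * p, a * q, a * q * s, y * p * s, y * p, b * q, b * q * r;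
     t * p * s, t * p, d * q, d * q * r, z * p * r, z * p, c * q, c * q * s]

/-- The weight pattern `N` after 3 urban renewals, up to a change of weights at the vertices. -/
noncomputable def patternRenewed3 (a b c d x y z t p q r s : ℝ) : Matrix (Fin 4) (Fin 8) ℝ :=
  !![s * p / d, r * q / t, q / t, p / c, r * p / c, s * q / z, q / z, p / d;
     s * q / x, r * p / a, p / a, q / y, r * q / y, s * p / b, p / b, q / x;
     r * q / t, s * p / d, p / d, q / z, s * q / z, r * p / c, p / c, q / t;
     r * p / a, s * q / x, q / x, p / b, s * p / b, r * q / y, q / y, p / a]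

/-- The weight pattern `N` after 4 urban renewals, up to a change of weights at the vertices. -/
noncomputable def patternRenewed4 (a b c d x y z t p q r s : ℝ) : Matrix (Fin 4) (Fin 8) ℝ :=
  !![p / (d * r), y * t * a * p / r, a * c * y * q / r, q / (z * r), p / (c * s),
    b * x * z * p / s, b * d * x * q / s, q / (t * s);
     p / (a * s), d * x * z * p / s, b * d * z * q / s, q / (y * s), p / (b * r),
       c * y * t * p / r, a * c * t * q / r, q / (x * r);
     q / (t * s), b * d * x * q / s, b * x * z * p / s, p / (c * s), q / (z * r),
       a * c * y * q / r, a * y * t * p / r, p / (d * r);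
     q / (x * r), a * c * t * q / r, c * y * t * p / r, p / (b * r), q / (y * s),
       b * d * z * q / s, d * x * z * p / s, p / (a * s)]

/-- The weight pattern `N` after 5 urban renewals, up to a change of weights at the vertices. -/
noncomputable def patternRenewed5 (a b c d x y z t : ℝ) : Matrix (Fin 4) (Fin 8) ℝ :=
  !![1 / d, 1 / z, a * c * y, b * x * z, 1 / c, 1 / t, b * d * x, a * y * t;
     1 / x, 1 / b, c * y * t, b * d * z, 1 / y, 1 / a, d * x * z, a * c * t;
     1 / t, 1 / c, b * x * z, a * c * y, 1 / z, 1 / d, a * y * t, b * d * x;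
     1 / a, 1 / y, b * d * z, c * y * t, 1 / b, 1 / x, a * c * t, d * x * z]

/-- The weight pattern `N` after 6 urban renewals, up to a change of weights at the vertices. -/
noncomputable def patternRenewed6 (a b c d x y z t e f : ℝ) : Matrix (Fin 4) (Fin 8) ℝ :=
  !![b * x * z * f, b * x * z, a * c * y, a * c * y * e, a * y * t * e, a * y * t, b * d * x,
    b * d * x * f;
     c * y * t * e, c * y * t, b * d * z, b * d * z * f, d * x * z * f, d * x * z, a * c * t,
       a * c * t * e;
     a * c * y * e, a * c * y, b * x * z, b * x * z * f, b * d * x * f, b * d * x, a * y * t,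
       a * y * t * e;
     b * d * z * f, b * d * z, c * y * t, c * y * t * e, a * c * t * e, a * c * t, d * x * z,
       d * x * z * f]

/-- The weight pattern `N` after 7 urban renewals, up to a change of weights at the vertices. -/
noncomputable def patternRenewed7 (a b c d x y z t e f : ℝ) : Matrix (Fin 4) (Fin 8) ℝ :=
  !![f / (c * y * t), e / (b * d * z), 1 / (b * d * z), 1 / (d * x * z), e / (d * x * z), f /
    (a * c * t), 1 / (a * c * t), 1 / (c * y * t);
     f / (a * c * y), e / (b * x * z), 1 / (b * x * z), 1 / (b * d * x), e / (b * d * x), f /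
       (a * y * t), 1 / (a * y * t), 1 / (a * c * y);
     e / (b * d * z), f / (c * y * t), 1 / (c * y * t), 1 / (a * c * t), f / (a * c * t), e /
       (d * x * z), 1 / (d * x * z), 1 / (b * d * z);
     e / (b * x * z), f / (a * c * y), 1 / (a * c * y), 1 / (a * y * t), f / (a * y * t), e /
       (b * d * x), 1 / (b * d * x), 1 / (b * x * z)]

/-- The cells carry `Δ₁` and `Δ₂` in a checkerboard. The column factor `p * q` clears the
denominators, so the new weights are the old ones times the other of the two. -/
theorem isRenewal_patternN {a b c d x y z t p q : ℝ}
    (hp : 0 < p) (hq : 0 < q)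
    (h_p : p = a * c + b * d)
    (h_q : q = x * z + y * t) :
    IsRenewal (patternN a b c d x y z t) (patternRenewed1 a b c d x y z t p q)
      !![p, q, p, q;
        q, p, q, p]
      !![1, 1, 1, 1;
        1, 1, 1, 1]
      !![p * q, p * q, p * q, p * q;
        p * q, p * q, p * q, p * q] := by
  constructor
  · intro u v; fin_cases u <;> fin_cases v <;> simp <;> positivity
  · intro u v; fin_cases u <;> fin_cases v <;> simp
  · intro u v; fin_cases u <;> fin_cases v <;> simp <;> positivity
  · intro i hi j hj
    interval_cases i <;> interval_cases j <;>
      simp only [cellDelta, periodicWeight, patternN, Nat.reduceMul, Nat.reduceAdd,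
        Fin.reduceOfNat, Matrix.of_apply, Matrix.cons_val] <;>
      subst h_p h_q <;> ring
  · intro i hi j hj
    interval_cases i <;> interval_cases j <;>
      simp only [periodicWeight, patternN, patternRenewed1, Nat.reduceMul, Nat.reduceAdd,
        Nat.reduceDiv,
        Nat.reduceMod, Nat.reduceSub, Fin.reduceOfNat, Matrix.of_apply, Matrix.cons_val] <;>
      ring

theorem isRenewal_patternRenewed1 {a b c d x y z t p q C1 C2 r s : ℝ}
    (hr : 0 < r) (hs : 0 < s) (hC1 : 0 < C1) (hC2 : 0 < C2)
    (h_C1 : C1 = x * t * p ^ 2 + a * d * q ^ 2)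
    (h_C2 : C2 = y * z * p ^ 2 + b * c * q ^ 2)
    (h_r : r = a * c * q ^ 2 + y * t * p ^ 2)
    (h_s : s = b * d * q ^ 2 + x * z * p ^ 2) :
    IsRenewal (patternRenewed1 a b c d x y z t p q) (patternRenewed2 a b c d x y z t p q r s)
      !![r, C1, s, C2;
        s, C1, r, C2]
      !![1, 1, 1, 1;
        1, 1, 1, 1]
      !![r * s, C1, r * s, C2;
        r * s, C1, r * s, C2] := by
  constructor
  · intro u v; fin_cases u <;> fin_cases v <;> simp <;> positivity
  · intro u v; fin_cases u <;> fin_cases v <;> simp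
  · intro u v; fin_cases u <;> fin_cases v <;> simp <;> positivity
  · intro i hi j hj
    interval_cases i <;> interval_cases j <;>
      simp only [cellDelta, periodicWeight, patternRenewed1, Nat.reduceMul, Nat.reduceAdd,
        Fin.reduceOfNat, Matrix.of_apply, Matrix.cons_val] <;>
      subst h_C1 h_C2 h_r h_s <;> ring
  · intro i hi j hj
    interval_cases i <;> interval_cases j <;>
      simp only [periodicWeight, patternRenewed1, patternRenewed2, Nat.reduceMul, Nat.reduceAdd,
        Nat.reduceDiv,
        Nat.reduceMod, Nat.reduceSub, Fin.reduceOfNat, Matrix.of_apply, Matrix.cons_val] <;>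
      ring

/-- In every cell the two products differ only in containing `r` or `s`, so their sum contains `r +
s`, which factors. This is the first appearance of `Δ₀`. -/
theorem isRenewal_patternRenewed2 {a b c d x y z t p q D0 r s : ℝ}
    (ha : 0 < a) (hb : 0 < b) (hc : 0 < c) (hd : 0 < d) (hx : 0 < x) (hy : 0 < y)
    (hz : 0 < z) (ht : 0 < t) (hp : 0 < p) (hq : 0 < q) (hD0 : 0 < D0) (hr : 0 < r)
    (hs : 0 < s)
    (h_RS : r + s = p * q * D0) :
    IsRenewal (patternRenewed2 a b c d x y z t p q r s) (patternRenewed3 a b c d x y z t p q r s)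
      !![a * d * p * q ^ 3 * D0, x * t * p ^ 3 * q * D0, b * c * p * q ^ 3 * D0,
        y * z * p ^ 3 * q * D0;
        x * t * p ^ 3 * q * D0, a * d * p * q ^ 3 * D0, y * z * p ^ 3 * q * D0,
          b * c * p * q ^ 3 * D0]
      !![1, 1, 1, 1;
        1, 1, 1, 1]
      !![p ^ 2 * q ^ 2 * D0, p ^ 2 * q ^ 2 * D0, p ^ 2 * q ^ 2 * D0, p ^ 2 * q ^ 2 * D0;
        p ^ 2 * q ^ 2 * D0, p ^ 2 * q ^ 2 * D0, p ^ 2 * q ^ 2 * D0, p ^ 2 * q ^ 2 * D0] := by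
  constructor
  · intro u v; fin_cases u <;> fin_cases v <;> simp <;> positivity
  · intro u v; fin_cases u <;> fin_cases v <;> simp
  · intro u v; fin_cases u <;> fin_cases v <;> simp <;> positivity
  · intro i hi j hj
    interval_cases i <;> interval_cases j <;>
      simp only [cellDelta, periodicWeight, patternRenewed2, Nat.reduceMul, Nat.reduceAdd,
        Fin.reduceOfNat, Matrix.of_apply, Matrix.cons_val] <;>
      obtain rfl : s = p * q * D0 - r := (by linarith) <;> ring
  · intro i hi j hj
    interval_cases i <;> interval_cases j <;>
      simp only [periodicWeight, patternRenewed2, patternRenewed3, Nat.reduceMul, Nat.reduceAdd,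
        Nat.reduceDiv,
        Nat.reduceMod, Nat.reduceSub, Fin.reduceOfNat, Matrix.of_apply, Matrix.cons_val] <;>
      field_simp

/-- `C₁` and `C₂` recur as cell weights, and the column factors absorb them, so the next pattern is
free of both. -/
theorem isRenewal_patternRenewed3 {a b c d x y z t p q C1 C2 r s : ℝ}
    (ha : 0 < a) (hb : 0 < b) (hc : 0 < c) (hd : 0 < d) (hx : 0 < x) (hy : 0 < y)
    (hz : 0 < z) (ht : 0 < t) (hp : 0 < p) (hq : 0 < q) (hC1 : 0 < C1) (hC2 : 0 < C2)
    (hr : 0 < r) (hs : 0 < s)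
    (h_C1 : C1 = x * t * p ^ 2 + a * d * q ^ 2)
    (h_C2 : C2 = y * z * p ^ 2 + b * c * q ^ 2)
    (h_r : r = a * c * q ^ 2 + y * t * p ^ 2)
    (h_s : s = b * d * q ^ 2 + x * z * p ^ 2) :
    IsRenewal (patternRenewed3 a b c d x y z t p q r s) (patternRenewed4 a b c d x y z t p q r s)
      !![r * s * C1 / (a * d * x * t), r / (a * c * y * t), r * s * C2 / (b * c * y * z), s /
        (b * d * x * z);
        r * s * C1 / (a * d * x * t), s / (b * d * x * z), r * s * C2 / (b * c * y * z), r /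
          (a * c * y * t)]
      !![1, 1, 1, 1;
        1, 1, 1, 1]
      !![C1 / (a * d * x * t), 1, C2 / (b * c * y * z), 1;
        C1 / (a * d * x * t), 1, C2 / (b * c * y * z), 1] := by
  constructor
  · intro u v; fin_cases u <;> fin_cases v <;> simp <;> positivity
  · intro u v; fin_cases u <;> fin_cases v <;> simp
  · intro u v; fin_cases u <;> fin_cases v <;> simp <;> positivity
  · intro i hi j hj
    interval_cases i <;> interval_cases j <;>
      simp only [cellDelta, periodicWeight, patternRenewed3, Nat.reduceMul, Nat.reduceAdd,
        Fin.reduceOfNat, Matrix.of_apply, Matrix.cons_val] <;>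
      field_simp <;> subst h_C1 h_C2 h_r h_s <;> ring
  · intro i hi j hj
    interval_cases i <;> interval_cases j <;>
      simp only [periodicWeight, patternRenewed3, patternRenewed4, Nat.reduceMul, Nat.reduceAdd,
        Nat.reduceDiv,
        Nat.reduceMod, Nat.reduceSub, Fin.reduceOfNat, Matrix.of_apply, Matrix.cons_val] <;>
      field_simp

/-- Here `p`, `q`, `r` and `s` leave the weights altogether; the pattern that remains involves only
the eight original variables. -/
theorem isRenewal_patternRenewed4 {a b c d x y z t p q r s : ℝ}
    (ha : 0 < a) (hb : 0 < b) (hc : 0 < c) (hd : 0 < d) (hx : 0 < x) (hy : 0 < y)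
    (hz : 0 < z) (ht : 0 < t) (hp : 0 < p) (hq : 0 < q) (hr : 0 < r) (hs : 0 < s)
    (h_p : p = a * c + b * d)
    (h_q : q = x * z + y * t) :
    IsRenewal (patternRenewed4 a b c d x y z t p q r s) (patternRenewed5 a b c d x y z t)
      !![p ^ 2 * q / (r * s), p * q ^ 2 / (r * s), p ^ 2 * q / (r * s), p * q ^ 2 / (r * s);
        p * q ^ 2 / (r * s), p ^ 2 * q / (r * s), p * q ^ 2 / (r * s), p ^ 2 * q / (r * s)]
      !![1, 1, 1, 1;
        1, 1, 1, 1]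
      !![p * q / s, p * q / s, p * q / r, p * q / r;
        p * q / r, p * q / r, p * q / s, p * q / s] := by
  constructor
  · intro u v; fin_cases u <;> fin_cases v <;> simp <;> positivity
  · intro u v; fin_cases u <;> fin_cases v <;> simp
  · intro u v; fin_cases u <;> fin_cases v <;> simp <;> positivity
  · intro i hi j hj
    interval_cases i <;> interval_cases j <;>
      simp only [cellDelta, periodicWeight, patternRenewed4, Nat.reduceMul, Nat.reduceAdd,
        Fin.reduceOfNat, Matrix.of_apply, Matrix.cons_val] <;>
      field_simp <;> subst h_p h_q <;> ring
  · intro i hi j hj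
    interval_cases i <;> interval_cases j <;>
      simp only [periodicWeight, patternRenewed4, patternRenewed5, Nat.reduceMul, Nat.reduceAdd,
        Nat.reduceDiv,
        Nat.reduceMod, Nat.reduceSub, Fin.reduceOfNat, Matrix.of_apply, Matrix.cons_val] <;>
      field_simp

theorem isRenewal_patternRenewed5 {a b c d x y z t e f E1 E2 : ℝ}
    (ha : 0 < a) (hb : 0 < b) (hc : 0 < c) (hd : 0 < d) (hx : 0 < x) (hy : 0 < y)
    (hz : 0 < z) (ht : 0 < t) (he : 0 < e) (hf : 0 < f) (hE1 : 0 < E1) (hE2 : 0 < E2)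
    (h_e : e = b * d + x * z)
    (h_f : f = a * c + y * t)
    (h_E1 : E1 = a * d + x * t)
    (h_E2 : E2 = b * c + y * z) :
    IsRenewal (patternRenewed5 a b c d x y z t) (patternRenewed6 a b c d x y z t e f)
      !![e / (b * d * x * z), b * c * y * z * E1, f / (a * c * y * t), a * d * x * t * E2;
        f / (a * c * y * t), b * c * y * z * E1, e / (b * d * x * z), a * d * x * t * E2]
      !![1, 1, 1, 1;
        1, 1, 1, 1]
      !![e * f, b * c * y * z * E1, e * f, a * d * x * t * E2;
        e * f, b * c * y * z * E1, e * f, a * d * x * t * E2] := by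
  constructor
  · intro u v; fin_cases u <;> fin_cases v <;> simp <;> positivity
  · intro u v; fin_cases u <;> fin_cases v <;> simp
  · intro u v; fin_cases u <;> fin_cases v <;> simp <;> positivity
  · intro i hi j hj
    interval_cases i <;> interval_cases j <;>
      simp only [cellDelta, periodicWeight, patternRenewed5, Nat.reduceMul, Nat.reduceAdd,
        Fin.reduceOfNat, Matrix.of_apply, Matrix.cons_val] <;>
      field_simp <;> subst h_e h_f h_E1 h_E2 <;> ring
  · intro i hi j hj
    interval_cases i <;> interval_cases j <;>
      simp only [periodicWeight, patternRenewed5, patternRenewed6, Nat.reduceMul, Nat.reduceAdd,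
        Nat.reduceDiv,
        Nat.reduceMod, Nat.reduceSub, Fin.reduceOfNat, Matrix.of_apply, Matrix.cons_val] <;>
      field_simp

/-- The same mechanism as in the third renewal: each cell contains `e + f`, which is `Δ₀`. -/
theorem isRenewal_patternRenewed6 {a b c d x y z t D0 e f : ℝ}
    (ha : 0 < a) (hb : 0 < b) (hc : 0 < c) (hd : 0 < d) (hx : 0 < x) (hy : 0 < y)
    (hz : 0 < z) (ht : 0 < t) (hD0 : 0 < D0) (he : 0 < e) (hf : 0 < f)
    (h_RS : e + f = D0) :
    IsRenewal (patternRenewed6 a b c d x y z t e f) (patternRenewed7 a b c d x y z t e f)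
      !![b * c * x * y * z * t * D0, a * b * c * d * y * z * D0, a * d * x * y * z * t * D0,
        a * b * c * d * x * t * D0;
        a * b * c * d * y * z * D0, b * c * x * y * z * t * D0, a * b * c * d * x * t * D0,
          a * d * x * y * z * t * D0]
      !![1, 1, 1, 1;
        1, 1, 1, 1]
      !![D0, D0, D0, D0;
        D0, D0, D0, D0] := by
  constructor
  · intro u v; fin_cases u <;> fin_cases v <;> simp <;> positivity
  · intro u v; fin_cases u <;> fin_cases v <;> simp
  · intro u v; fin_cases u <;> fin_cases v <;> simp <;> positivity
  · intro i hi j hj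
    interval_cases i <;> interval_cases j <;>
      simp only [cellDelta, periodicWeight, patternRenewed6, Nat.reduceMul, Nat.reduceAdd,
        Fin.reduceOfNat, Matrix.of_apply, Matrix.cons_val] <;>
      subst h_RS <;> ring
  · intro i hi j hj
    interval_cases i <;> interval_cases j <;>
      simp only [periodicWeight, patternRenewed6, patternRenewed7, Nat.reduceMul, Nat.reduceAdd,
        Nat.reduceDiv,
        Nat.reduceMod, Nat.reduceSub, Fin.reduceOfNat, Matrix.of_apply, Matrix.cons_val] <;>
      field_simp

/-- The cycle closes. Nontrivial row factors `g` are used only here, so that `N` comes back exactly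
rather than up to a change of weights at the vertices. -/
theorem isRenewal_patternRenewed7 {a b c d x y z t e f E1 E2 : ℝ}
    (ha : 0 < a) (hb : 0 < b) (hc : 0 < c) (hd : 0 < d) (hx : 0 < x) (hy : 0 < y)
    (hz : 0 < z) (ht : 0 < t) (he : 0 < e) (hf : 0 < f) (hE1 : 0 < E1) (hE2 : 0 < E2)
    (h_e : e = b * d + x * z)
    (h_f : f = a * c + y * t)
    (h_E1 : E1 = a * d + x * t)
    (h_E2 : E2 = b * c + y * z) :
    IsRenewal (patternRenewed7 a b c d x y z t e f) (patternN a b c d x y z t)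
      !![e * f * E1 / (a * b * c * d * x * y * z * t), e / (b * d * x * z) ^ 2, e * f * E2 /
        (a * b * c * d * x * y * z * t), f / (a * c * y * t) ^ 2;
        e * f * E1 / (a * b * c * d * x * y * z * t), f / (a * c * y * t) ^ 2, e * f * E2 /
          (a * b * c * d * x * y * z * t), e / (b * d * x * z) ^ 2]
      !![e, e, f * (b * d * x * z) / (a * c * y * t), f * (b * d * x * z) / (a * c * y * t);
        f * (b * d * x * z) / (a * c * y * t), f * (b * d * x * z) / (a * c * y * t), e, e]
      !![E1 / (b * d * x * z), 1 / (b * d * x * z), E2 / (b * d * x * z), 1 / (b * d * x * z);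
        E1 / (b * d * x * z), 1 / (b * d * x * z), E2 / (b * d * x * z), 1 / (b * d * x * z)] := by
  constructor
  · intro u v; fin_cases u <;> fin_cases v <;> simp <;> positivity
  · intro u v; fin_cases u <;> fin_cases v <;> simp <;> positivity
  · intro u v; fin_cases u <;> fin_cases v <;> simp <;> positivity
  · intro i hi j hj
    interval_cases i <;> interval_cases j <;>
      simp only [cellDelta, periodicWeight, patternRenewed7, Nat.reduceMul, Nat.reduceAdd,
        Fin.reduceOfNat, Matrix.of_apply, Matrix.cons_val] <;>
      field_simp <;> subst h_e h_f h_E1 h_E2 <;> ring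
  · intro i hi j hj
    interval_cases i <;> interval_cases j <;>
      simp only [periodicWeight, patternRenewed7, patternN, Nat.reduceMul, Nat.reduceAdd,
        Nat.reduceDiv,
        Nat.reduceMod, Nat.reduceSub, Fin.reduceOfNat, Matrix.of_apply, Matrix.cons_val] <;>
      field_simp

/-! ### Logarithms of the renewal factors. -/

theorem periodicSum_map_log_one (m n : ℕ) :
    periodicSum ((!![1, 1, 1, 1; 1, 1, 1, 1] : Matrix (Fin 2) (Fin 4) ℝ).map Real.log) m n = 0 := by
  refine Finset.sum_eq_zero fun u _ => Finset.sum_eq_zero fun v _ => ?_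
  fin_cases u <;> fin_cases v <;> simp

/-- The logarithm of the factor by which the matching generating function changes in the renewal
number
`1`, in terms of the logarithms of the polynomials involved. -/
def renewalLog0 (lp lq : ℝ) (n : ℕ) : ℝ :=
  periodicSum
      !![lp, lq, lp, lq;
        lq, lp, lq, lp] (n + 1) (n + 1) -
    periodicSum
      !![lp + lq, lp + lq, lp + lq, lp + lq;
        lp + lq, lp + lq, lp + lq, lp + lq] n (n + 1)

theorem log_diamondSum_patternN {a b c d x y z t p q : ℝ}
    (hp : 0 < p) (hq : 0 < q)
    (h_p : p = a * c + b * d)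
    (h_q : q = x * z + y * t)
    {n : ℕ} (hn : 0 < diamondSum n True (periodicWeight (patternRenewed1 a b c d x y z t p q))) :
    0 < diamondSum (n + 1) True (periodicWeight (patternN a b c d x y z t)) ∧
    Real.log (diamondSum (n + 1) True (periodicWeight (patternN a b c d x y z t))) =
      renewalLog0 (Real.log p) (Real.log q) n +
        Real.log (diamondSum n True (periodicWeight (patternRenewed1 a b c d x y z t p q))) := by
  obtain ⟨h1, h2⟩ := (isRenewal_patternN hp hq h_p h_q).log_diamondSum hn
  refine ⟨h1, h2.trans ?_⟩
  rw [renewalLog0]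
  rw [periodicSum_map_log_one, sub_zero]
  -- The logarithm of each matrix entry is expanded into a linear form in the logarithms of its
  -- factors.
  congr 3
  · ext u v; fin_cases u <;> fin_cases v <;>
      simp (disch := positivity) [Real.log_mul, Real.log_div, Real.log_pow] <;> ring
  · ext u v; fin_cases u <;> fin_cases v <;>
      simp (disch := positivity) [Real.log_mul, Real.log_div, Real.log_pow] <;> ring

/-- The logarithm of the factor by which the matching generating function changes in the renewal
number
`2`, in terms of the logarithms of the polynomials involved. -/
def renewalLog1 (lC1 lC2 lr ls : ℝ) (n : ℕ) : ℝ :=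
  periodicSum
      !![lr, lC1, ls, lC2;
        ls, lC1, lr, lC2] (n + 1) (n + 1) -
    periodicSum
      !![lr + ls, lC1, lr + ls, lC2;
        lr + ls, lC1, lr + ls, lC2] n (n + 1)

theorem log_diamondSum_patternRenewed1 {a b c d x y z t p q C1 C2 r s : ℝ}
    (hr : 0 < r) (hs : 0 < s) (hC1 : 0 < C1) (hC2 : 0 < C2)
    (h_C1 : C1 = x * t * p ^ 2 + a * d * q ^ 2)
    (h_C2 : C2 = y * z * p ^ 2 + b * c * q ^ 2)
    (h_r : r = a * c * q ^ 2 + y * t * p ^ 2)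
    (h_s : s = b * d * q ^ 2 + x * z * p ^ 2)
    {n : ℕ} (hn : 0 < diamondSum n True (periodicWeight (patternRenewed2 a b c d x y z t p q r s)))
      :
    0 < diamondSum (n + 1) True (periodicWeight (patternRenewed1 a b c d x y z t p q)) ∧
    Real.log (diamondSum (n + 1) True (periodicWeight (patternRenewed1 a b c d x y z t p q))) =
      renewalLog1 (Real.log C1) (Real.log C2) (Real.log r) (Real.log s) n +
        Real.log (diamondSum n True (periodicWeight (patternRenewed2 a b c d x y z t p q r s))) :=
          by
  obtain ⟨h1, h2⟩ := (isRenewal_patternRenewed1 hr hs hC1 hC2 h_C1 h_C2 h_r h_s).log_diamondSum hn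
  refine ⟨h1, h2.trans ?_⟩
  rw [renewalLog1]
  rw [periodicSum_map_log_one, sub_zero]
  congr 3
  · ext u v; fin_cases u <;> fin_cases v <;>
      simp (disch := positivity) [Real.log_mul, Real.log_div, Real.log_pow] <;> ring
  · ext u v; fin_cases u <;> fin_cases v <;>
      simp (disch := positivity) [Real.log_mul, Real.log_div, Real.log_pow] <;> ring

/-- The logarithm of the factor by which the matching generating function changes in the renewal
number
`3`, in terms of the logarithms of the polynomials involved. -/
def renewalLog2 (la lb lc ld lx ly lz lt lp lq lD0 : ℝ) (n : ℕ) : ℝ :=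
  periodicSum
      !![3 * lq + la + ld + lp + lD0, 3 * lp + lx + lt + lq + lD0, 3 * lq + lb + lc + lp + lD0,
        3 * lp + ly + lz + lq + lD0;
        3 * lp + lx + lt + lq + lD0, 3 * lq + la + ld + lp + lD0, 3 * lp + ly + lz + lq + lD0,
          3 * lq + lb + lc + lp + lD0] (n + 1) (n + 1) -
    periodicSum
      !![2 * lp + 2 * lq + lD0, 2 * lp + 2 * lq + lD0, 2 * lp + 2 * lq + lD0, 2 * lp + 2 * lq + lD0;
        2 * lp + 2 * lq + lD0, 2 * lp + 2 * lq + lD0, 2 * lp + 2 * lq + lD0,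
          2 * lp + 2 * lq + lD0] n (n + 1)

theorem log_diamondSum_patternRenewed2 {a b c d x y z t p q D0 r s : ℝ}
    (ha : 0 < a) (hb : 0 < b) (hc : 0 < c) (hd : 0 < d) (hx : 0 < x) (hy : 0 < y)
    (hz : 0 < z) (ht : 0 < t) (hp : 0 < p) (hq : 0 < q) (hD0 : 0 < D0) (hr : 0 < r)
    (hs : 0 < s)
    (h_RS : r + s = p * q * D0)
    {n : ℕ} (hn : 0 < diamondSum n True (periodicWeight (patternRenewed3 a b c d x y z t p q r s)))
      :
    0 < diamondSum (n + 1) True (periodicWeight (patternRenewed2 a b c d x y z t p q r s)) ∧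
    Real.log (diamondSum (n + 1) True (periodicWeight (patternRenewed2 a b c d x y z t p q r s))) =
      renewalLog2 (Real.log a) (Real.log b) (Real.log c) (Real.log d) (Real.log x) (Real.log y)
        (Real.log z) (Real.log t) (Real.log p) (Real.log q) (Real.log D0) n +
        Real.log (diamondSum n True (periodicWeight (patternRenewed3 a b c d x y z t p q r s))) :=
          by
  obtain ⟨h1, h2⟩ := (isRenewal_patternRenewed2 ha hb hc hd hx hy hz ht hp hq hD0 hr hs
    h_RS).log_diamondSum hn
  refine ⟨h1, h2.trans ?_⟩
  rw [renewalLog2]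
  rw [periodicSum_map_log_one, sub_zero]
  congr 3
  · ext u v; fin_cases u <;> fin_cases v <;>
      simp (disch := positivity) [Real.log_mul, Real.log_div, Real.log_pow] <;> ring
  · ext u v; fin_cases u <;> fin_cases v <;>
      simp (disch := positivity) [Real.log_mul, Real.log_div, Real.log_pow] <;> ring

/-- The logarithm of the factor by which the matching generating function changes in the renewal
number
`4`, in terms of the logarithms of the polynomials involved. -/
def renewalLog3 (la lb lc ld lx ly lz lt lC1 lC2 lr ls : ℝ) (n : ℕ) : ℝ :=
  periodicSum
      !![lr + ls + lC1 - la - ld - lx - lt, lr - la - lc - ly - lt,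
        lr + ls + lC2 - lb - lc - ly - lz, ls - lb - ld - lx - lz;
        lr + ls + lC1 - la - ld - lx - lt, ls - lb - ld - lx - lz,
          lr + ls + lC2 - lb - lc - ly - lz, lr - la - lc - ly - lt] (n + 1) (n + 1) -
    periodicSum
      !![lC1 - la - ld - lx - lt, 0, lC2 - lb - lc - ly - lz, 0;
        lC1 - la - ld - lx - lt, 0, lC2 - lb - lc - ly - lz, 0] n (n + 1)

theorem log_diamondSum_patternRenewed3 {a b c d x y z t p q C1 C2 r s : ℝ}
    (ha : 0 < a) (hb : 0 < b) (hc : 0 < c) (hd : 0 < d) (hx : 0 < x) (hy : 0 < y)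
    (hz : 0 < z) (ht : 0 < t) (hp : 0 < p) (hq : 0 < q) (hC1 : 0 < C1) (hC2 : 0 < C2)
    (hr : 0 < r) (hs : 0 < s)
    (h_C1 : C1 = x * t * p ^ 2 + a * d * q ^ 2)
    (h_C2 : C2 = y * z * p ^ 2 + b * c * q ^ 2)
    (h_r : r = a * c * q ^ 2 + y * t * p ^ 2)
    (h_s : s = b * d * q ^ 2 + x * z * p ^ 2)
    {n : ℕ} (hn : 0 < diamondSum n True (periodicWeight (patternRenewed4 a b c d x y z t p q r s)))
      :
    0 < diamondSum (n + 1) True (periodicWeight (patternRenewed3 a b c d x y z t p q r s)) ∧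
    Real.log (diamondSum (n + 1) True (periodicWeight (patternRenewed3 a b c d x y z t p q r s))) =
      renewalLog3 (Real.log a) (Real.log b) (Real.log c) (Real.log d) (Real.log x) (Real.log y)
        (Real.log z) (Real.log t) (Real.log C1) (Real.log C2) (Real.log r) (Real.log s) n +
        Real.log (diamondSum n True (periodicWeight (patternRenewed4 a b c d x y z t p q r s))) :=
          by
  obtain ⟨h1, h2⟩ := (isRenewal_patternRenewed3 ha hb hc hd hx hy hz ht hp hq hC1 hC2 hr hs h_C1
    h_C2 h_r h_s).log_diamondSum hn
  refine ⟨h1, h2.trans ?_⟩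
  rw [renewalLog3]
  rw [periodicSum_map_log_one, sub_zero]
  congr 3
  · ext u v; fin_cases u <;> fin_cases v <;>
      simp (disch := positivity) [Real.log_mul, Real.log_div, Real.log_pow] <;> ring
  · ext u v; fin_cases u <;> fin_cases v <;>
      simp (disch := positivity) [Real.log_mul, Real.log_div, Real.log_pow] <;> ring

/-- The logarithm of the factor by which the matching generating function changes in the renewal
number
`5`, in terms of the logarithms of the polynomials involved. -/
def renewalLog4 (lp lq lr ls : ℝ) (n : ℕ) : ℝ :=
  periodicSum
      !![2 * lp + lq - lr - ls, 2 * lq + lp - lr - ls, 2 * lp + lq - lr - ls, 2 * lq + lp - lr - ls;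
        2 * lq + lp - lr - ls, 2 * lp + lq - lr - ls, 2 * lq + lp - lr - ls,
          2 * lp + lq - lr - ls] (n + 1) (n + 1) -
    periodicSum
      !![lp + lq - ls, lp + lq - ls, lp + lq - lr, lp + lq - lr;
        lp + lq - lr, lp + lq - lr, lp + lq - ls, lp + lq - ls] n (n + 1)

theorem log_diamondSum_patternRenewed4 {a b c d x y z t p q r s : ℝ}
    (ha : 0 < a) (hb : 0 < b) (hc : 0 < c) (hd : 0 < d) (hx : 0 < x) (hy : 0 < y)
    (hz : 0 < z) (ht : 0 < t) (hp : 0 < p) (hq : 0 < q) (hr : 0 < r) (hs : 0 < s)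
    (h_p : p = a * c + b * d)
    (h_q : q = x * z + y * t)
    {n : ℕ} (hn : 0 < diamondSum n True (periodicWeight (patternRenewed5 a b c d x y z t))) :
    0 < diamondSum (n + 1) True (periodicWeight (patternRenewed4 a b c d x y z t p q r s)) ∧
    Real.log (diamondSum (n + 1) True (periodicWeight (patternRenewed4 a b c d x y z t p q r s))) =
      renewalLog4 (Real.log p) (Real.log q) (Real.log r) (Real.log s) n +
        Real.log (diamondSum n True (periodicWeight (patternRenewed5 a b c d x y z t))) := by
  obtain ⟨h1, h2⟩ := (isRenewal_patternRenewed4 ha hb hc hd hx hy hz ht hp hq hr hs h_p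
    h_q).log_diamondSum hn
  refine ⟨h1, h2.trans ?_⟩
  rw [renewalLog4]
  rw [periodicSum_map_log_one, sub_zero]
  congr 3
  · ext u v; fin_cases u <;> fin_cases v <;>
      simp (disch := positivity) [Real.log_mul, Real.log_div, Real.log_pow] <;> ring
  · ext u v; fin_cases u <;> fin_cases v <;>
      simp (disch := positivity) [Real.log_mul, Real.log_div, Real.log_pow] <;> ring

/-- The logarithm of the factor by which the matching generating function changes in the renewal
number
`6`, in terms of the logarithms of the polynomials involved. -/
def renewalLog5 (la lb lc ld lx ly lz lt le lf lE1 lE2 : ℝ) (n : ℕ) : ℝ :=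
  periodicSum
      !![le - lb - ld - lx - lz, lb + lc + ly + lz + lE1, lf - la - lc - ly - lt,
        la + ld + lx + lt + lE2;
        lf - la - lc - ly - lt, lb + lc + ly + lz + lE1, le - lb - ld - lx - lz,
          la + ld + lx + lt + lE2] (n + 1) (n + 1) -
    periodicSum
      !![le + lf, lb + lc + ly + lz + lE1, le + lf, la + ld + lx + lt + lE2;
        le + lf, lb + lc + ly + lz + lE1, le + lf, la + ld + lx + lt + lE2] n (n + 1)

theorem log_diamondSum_patternRenewed5 {a b c d x y z t e f E1 E2 : ℝ}
    (ha : 0 < a) (hb : 0 < b) (hc : 0 < c) (hd : 0 < d) (hx : 0 < x) (hy : 0 < y)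
    (hz : 0 < z) (ht : 0 < t) (he : 0 < e) (hf : 0 < f) (hE1 : 0 < E1) (hE2 : 0 < E2)
    (h_e : e = b * d + x * z)
    (h_f : f = a * c + y * t)
    (h_E1 : E1 = a * d + x * t)
    (h_E2 : E2 = b * c + y * z)
    {n : ℕ} (hn : 0 < diamondSum n True (periodicWeight (patternRenewed6 a b c d x y z t e f))) :
    0 < diamondSum (n + 1) True (periodicWeight (patternRenewed5 a b c d x y z t)) ∧
    Real.log (diamondSum (n + 1) True (periodicWeight (patternRenewed5 a b c d x y z t))) =
      renewalLog5 (Real.log a) (Real.log b) (Real.log c) (Real.log d) (Real.log x) (Real.log y)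
        (Real.log z) (Real.log t) (Real.log e) (Real.log f) (Real.log E1) (Real.log E2) n +
        Real.log (diamondSum n True (periodicWeight (patternRenewed6 a b c d x y z t e f))) := by
  obtain ⟨h1, h2⟩ := (isRenewal_patternRenewed5 ha hb hc hd hx hy hz ht he hf hE1 hE2 h_e h_f h_E1
    h_E2).log_diamondSum hn
  refine ⟨h1, h2.trans ?_⟩
  rw [renewalLog5]
  rw [periodicSum_map_log_one, sub_zero]
  congr 3
  · ext u v; fin_cases u <;> fin_cases v <;>
      simp (disch := positivity) [Real.log_mul, Real.log_div, Real.log_pow] <;> ring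
  · ext u v; fin_cases u <;> fin_cases v <;>
      simp (disch := positivity) [Real.log_mul, Real.log_div, Real.log_pow] <;> ring

/-- The logarithm of the factor by which the matching generating function changes in the renewal
number
`7`, in terms of the logarithms of the polynomials involved. -/
def renewalLog6 (la lb lc ld lx ly lz lt lD0 : ℝ) (n : ℕ) : ℝ :=
  periodicSum
      !![lb + lc + lx + ly + lz + lt + lD0, la + lb + lc + ld + ly + lz + lD0,
        la + ld + lx + ly + lz + lt + lD0, la + lb + lc + ld + lx + lt + lD0;
        la + lb + lc + ld + ly + lz + lD0, lb + lc + lx + ly + lz + lt + lD0,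
          la + lb + lc + ld + lx + lt + lD0, la + ld + lx + ly + lz + lt + lD0] (n + 1) (n + 1) -
    periodicSum
      !![lD0, lD0, lD0, lD0;
        lD0, lD0, lD0, lD0] n (n + 1)

theorem log_diamondSum_patternRenewed6 {a b c d x y z t D0 e f : ℝ}
    (ha : 0 < a) (hb : 0 < b) (hc : 0 < c) (hd : 0 < d) (hx : 0 < x) (hy : 0 < y)
    (hz : 0 < z) (ht : 0 < t) (hD0 : 0 < D0) (he : 0 < e) (hf : 0 < f)
    (h_RS : e + f = D0)
    {n : ℕ} (hn : 0 < diamondSum n True (periodicWeight (patternRenewed7 a b c d x y z t e f))) :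
    0 < diamondSum (n + 1) True (periodicWeight (patternRenewed6 a b c d x y z t e f)) ∧
    Real.log (diamondSum (n + 1) True (periodicWeight (patternRenewed6 a b c d x y z t e f))) =
      renewalLog6 (Real.log a) (Real.log b) (Real.log c) (Real.log d) (Real.log x) (Real.log y)
        (Real.log z) (Real.log t) (Real.log D0) n +
        Real.log (diamondSum n True (periodicWeight (patternRenewed7 a b c d x y z t e f))) := by
  obtain ⟨h1, h2⟩ := (isRenewal_patternRenewed6 ha hb hc hd hx hy hz ht hD0 he hf
    h_RS).log_diamondSum hn
  refine ⟨h1, h2.trans ?_⟩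
  rw [renewalLog6]
  rw [periodicSum_map_log_one, sub_zero]
  congr 3
  · ext u v; fin_cases u <;> fin_cases v <;>
      simp (disch := positivity) [Real.log_mul, Real.log_div, Real.log_pow] <;> ring
  · ext u v; fin_cases u <;> fin_cases v <;>
      simp (disch := positivity) [Real.log_mul, Real.log_div, Real.log_pow] <;> ring

/-- The logarithm of the factor by which the matching generating function changes in the renewal
number
`8`, in terms of the logarithms of the polynomials involved. -/
def renewalLog7 (la lb lc ld lx ly lz lt le lf lE1 lE2 : ℝ) (n : ℕ) : ℝ :=
  periodicSum
      !![le + lf + lE1 - la - lb - lc - ld - lx - ly - lz - lt,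
        le - 2 * lb - 2 * ld - 2 * lx - 2 * lz, le + lf + lE2 - la - lb - lc - ld - lx - ly - lz -
        lt, lf - 2 * la - 2 * lc - 2 * ly - 2 * lt;
        le + lf + lE1 - la - lb - lc - ld - lx - ly - lz - lt,
          lf - 2 * la - 2 * lc - 2 * ly - 2 * lt, le + lf + lE2 - la - lb - lc - ld - lx - ly - lz
          - lt, le - 2 * lb - 2 * ld - 2 * lx - 2 * lz] (n + 1) (n + 1) -
    periodicSum
      !![le, le, lf + lb + ld + lx + lz - la - lc - ly - lt,
        lf + lb + ld + lx + lz - la - lc - ly - lt;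
        lf + lb + ld + lx + lz - la - lc - ly - lt, lf + lb + ld + lx + lz - la - lc - ly - lt,
          le, le] (n + 1) n -
    periodicSum
      !![lE1 - lb - ld - lx - lz, -lb - ld - lx - lz, lE2 - lb - ld - lx - lz, -lb - ld - lx - lz;
        lE1 - lb - ld - lx - lz, -lb - ld - lx - lz, lE2 - lb - ld - lx - lz,
          -lb - ld - lx - lz] n (n + 1)

theorem log_diamondSum_patternRenewed7 {a b c d x y z t e f E1 E2 : ℝ}
    (ha : 0 < a) (hb : 0 < b) (hc : 0 < c) (hd : 0 < d) (hx : 0 < x) (hy : 0 < y)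
    (hz : 0 < z) (ht : 0 < t) (he : 0 < e) (hf : 0 < f) (hE1 : 0 < E1) (hE2 : 0 < E2)
    (h_e : e = b * d + x * z)
    (h_f : f = a * c + y * t)
    (h_E1 : E1 = a * d + x * t)
    (h_E2 : E2 = b * c + y * z)
    {n : ℕ} (hn : 0 < diamondSum n True (periodicWeight (patternN a b c d x y z t))) :
    0 < diamondSum (n + 1) True (periodicWeight (patternRenewed7 a b c d x y z t e f)) ∧
    Real.log (diamondSum (n + 1) True (periodicWeight (patternRenewed7 a b c d x y z t e f))) =
      renewalLog7 (Real.log a) (Real.log b) (Real.log c) (Real.log d) (Real.log x) (Real.log y)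
        (Real.log z) (Real.log t) (Real.log e) (Real.log f) (Real.log E1) (Real.log E2) n +
        Real.log (diamondSum n True (periodicWeight (patternN a b c d x y z t))) := by
  obtain ⟨h1, h2⟩ := (isRenewal_patternRenewed7 ha hb hc hd hx hy hz ht he hf hE1 hE2 h_e h_f h_E1
    h_E2).log_diamondSum hn
  refine ⟨h1, h2.trans ?_⟩
  rw [renewalLog7]
  congr 4
  · ext u v; fin_cases u <;> fin_cases v <;>
      simp (disch := positivity) [Real.log_mul, Real.log_div, Real.log_pow] <;> ring
  · ext u v; fin_cases u <;> fin_cases v <;>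
      simp (disch := positivity) [Real.log_mul, Real.log_div, Real.log_pow] <;> ring
  · ext u v; fin_cases u <;> fin_cases v <;>
      simp (disch := positivity) [Real.log_mul, Real.log_div, Real.log_pow] <;> ring

/-! ### Total factor of a cycle and of its initial segments. -/

/-- One full cycle, from order `4m + 8` down to `4m`. Each summand may be quadratic in `m`, but the
total is linear, and `lp`, `lq`, `lr`, `ls`, `le`, `lf` drop out. The order is written `4 * m + 0`
to fit `periodicSum_four_mul_add`. The next three lemmas treat the other residues. -/
theorem renewalLog_sum_four_mul_add_0 (la lb lc ld lx ly lz lt lp lq lD0 lC1 lC2 lr ls le lf lE1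
  lE2 : ℝ) (m : ℕ) :
    renewalLog0 lp lq (4 * m + 7) +
      renewalLog1 lC1 lC2 lr ls (4 * m + 6) +
      renewalLog2 la lb lc ld lx ly lz lt lp lq lD0 (4 * m + 5) +
      renewalLog3 la lb lc ld lx ly lz lt lC1 lC2 lr ls (4 * m + 4) +
      renewalLog4 lp lq lr ls (4 * m + 3) +
      renewalLog5 la lb lc ld lx ly lz lt le lf lE1 lE2 (4 * m + 2) +
      renewalLog6 la lb lc ld lx ly lz lt lD0 (4 * m + 1) +
      renewalLog7 la lb lc ld lx ly lz lt le lf lE1 lE2 (4 * m + 0) =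
    (8 * m + 8) * lD0 + (2 * m + 2) * lE1 + (2 * m) * lE2 + (2 * m + 4) * lC1 + (2 * m + 2) * lC2 +
      (2 * m + 3) * (la + ld + lx + lt) + (2 * m + 1) * (lb + lc + ly + lz) := by
  simp only [renewalLog0, renewalLog1, renewalLog2, renewalLog3, renewalLog4, renewalLog5,
    renewalLog6, renewalLog7, Nat.add_assoc,
    Nat.reduceAdd, periodicSum_four_mul_add, Fin.sum_univ_two, Fin.sum_univ_four, Matrix.of_apply,
    Matrix.cons_val, Fin.val_zero, Fin.val_one, Fin.val_two, Fin.coe_ofNat_eq_mod, Nat.reduceMod,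
      Nat.reduceSub,
    Nat.reduceDiv, Nat.cast_ofNat, Nat.cast_zero, Nat.cast_one]
  ring

theorem renewalLog_sum_four_mul_add_1 (la lb lc ld lx ly lz lt lp lq lD0 lC1 lC2 lr ls le lf lE1
  lE2 : ℝ) (m : ℕ) :
    renewalLog0 lp lq (4 * m + 8) +
      renewalLog1 lC1 lC2 lr ls (4 * m + 7) +
      renewalLog2 la lb lc ld lx ly lz lt lp lq lD0 (4 * m + 6) +
      renewalLog3 la lb lc ld lx ly lz lt lC1 lC2 lr ls (4 * m + 5) +
      renewalLog4 lp lq lr ls (4 * m + 4) +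
      renewalLog5 la lb lc ld lx ly lz lt le lf lE1 lE2 (4 * m + 3) +
      renewalLog6 la lb lc ld lx ly lz lt lD0 (4 * m + 2) +
      renewalLog7 la lb lc ld lx ly lz lt le lf lE1 lE2 (4 * m + 1) =
    (8 * m + 10) * lD0 + (2 * m + 2) * lE1 + (2 * m + 1) * lE2 + (2 * m + 4) * lC1 +
      (2 * m + 3) * lC2 +
      (2 * m + 3) * (la + ld + lx + lt) + (2 * m + 2) * (lb + lc + ly + lz) := by
  simp only [renewalLog0, renewalLog1, renewalLog2, renewalLog3, renewalLog4, renewalLog5,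
    renewalLog6, renewalLog7, Nat.add_assoc,
    Nat.reduceAdd, periodicSum_four_mul_add, Fin.sum_univ_two, Fin.sum_univ_four, Matrix.of_apply,
    Matrix.cons_val, Fin.val_zero, Fin.val_one, Fin.val_two, Fin.coe_ofNat_eq_mod, Nat.reduceMod,
      Nat.reduceSub,
    Nat.reduceDiv, Nat.cast_ofNat, Nat.cast_zero, Nat.cast_one]
  ring

theorem renewalLog_sum_four_mul_add_2 (la lb lc ld lx ly lz lt lp lq lD0 lC1 lC2 lr ls le lf lE1
  lE2 : ℝ) (m : ℕ) :
    renewalLog0 lp lq (4 * m + 9) +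
      renewalLog1 lC1 lC2 lr ls (4 * m + 8) +
      renewalLog2 la lb lc ld lx ly lz lt lp lq lD0 (4 * m + 7) +
      renewalLog3 la lb lc ld lx ly lz lt lC1 lC2 lr ls (4 * m + 6) +
      renewalLog4 lp lq lr ls (4 * m + 5) +
      renewalLog5 la lb lc ld lx ly lz lt le lf lE1 lE2 (4 * m + 4) +
      renewalLog6 la lb lc ld lx ly lz lt lD0 (4 * m + 3) +
      renewalLog7 la lb lc ld lx ly lz lt le lf lE1 lE2 (4 * m + 2) =
    (8 * m + 12) * lD0 + (2 * m + 2) * lE1 + (2 * m + 2) * lE2 + (2 * m + 4) * lC1 +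
      (2 * m + 4) * lC2 +
      (2 * m + 3) * (la + ld + lx + lt) + (2 * m + 3) * (lb + lc + ly + lz) := by
  simp only [renewalLog0, renewalLog1, renewalLog2, renewalLog3, renewalLog4, renewalLog5,
    renewalLog6, renewalLog7, Nat.add_assoc,
    Nat.reduceAdd, periodicSum_four_mul_add, Fin.sum_univ_two, Fin.sum_univ_four, Matrix.of_apply,
    Matrix.cons_val, Fin.val_zero, Fin.val_one, Fin.val_two, Fin.coe_ofNat_eq_mod, Nat.reduceMod,
      Nat.reduceSub,
    Nat.reduceDiv, Nat.cast_ofNat, Nat.cast_zero, Nat.cast_one]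
  ring

theorem renewalLog_sum_four_mul_add_3 (la lb lc ld lx ly lz lt lp lq lD0 lC1 lC2 lr ls le lf lE1
  lE2 : ℝ) (m : ℕ) :
    renewalLog0 lp lq (4 * m + 10) +
      renewalLog1 lC1 lC2 lr ls (4 * m + 9) +
      renewalLog2 la lb lc ld lx ly lz lt lp lq lD0 (4 * m + 8) +
      renewalLog3 la lb lc ld lx ly lz lt lC1 lC2 lr ls (4 * m + 7) +
      renewalLog4 lp lq lr ls (4 * m + 6) +
      renewalLog5 la lb lc ld lx ly lz lt le lf lE1 lE2 (4 * m + 5) +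
      renewalLog6 la lb lc ld lx ly lz lt lD0 (4 * m + 4) +
      renewalLog7 la lb lc ld lx ly lz lt le lf lE1 lE2 (4 * m + 3) =
    (8 * m + 14) * lD0 + (2 * m + 3) * lE1 + (2 * m + 2) * lE2 + (2 * m + 5) * lC1 +
      (2 * m + 4) * lC2 +
      (2 * m + 4) * (la + ld + lx + lt) + (2 * m + 3) * (lb + lc + ly + lz) := by
  simp only [renewalLog0, renewalLog1, renewalLog2, renewalLog3, renewalLog4, renewalLog5,
    renewalLog6, renewalLog7, Nat.add_assoc,
    Nat.reduceAdd, periodicSum_four_mul_add, Fin.sum_univ_two, Fin.sum_univ_four, Matrix.of_apply,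
    Matrix.cons_val, Fin.val_zero, Fin.val_one, Fin.val_two, Fin.coe_ofNat_eq_mod, Nat.reduceMod,
      Nat.reduceSub,
    Nat.reduceDiv, Nat.cast_ofNat, Nat.cast_zero, Nat.cast_one]
  ring

/-- For order `k < 8` only the first `k` renewals occur, ending at order `0`. As the cycle is
incomplete, quantities such as `lp`, `lr`, `lq` and `le` can survive, as in orders 1, 2, 3 and 6. -/
theorem renewalLog_sum_initial_1 (lp lq : ℝ) :
    renewalLog0 lp lq 0 =
    lp := by
  simp only [renewalLog0, Nat.reduceAdd, periodicSum,
    Fin.sum_univ_two, Fin.sum_univ_four, Matrix.of_apply, Matrix.cons_val, Fin.val_zero,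
      Fin.val_one,
    Fin.val_two, Fin.coe_ofNat_eq_mod, Nat.reduceMod, Nat.reduceSub, Nat.reduceDiv,
      Nat.cast_ofNat, Nat.cast_zero,
    Nat.cast_one]
  ring

theorem renewalLog_sum_initial_2 (lp lq lC1 lC2 lr ls : ℝ) :
    renewalLog0 lp lq 1 +
      renewalLog1 lC1 lC2 lr ls 0 =
    lr := by
  simp only [renewalLog0, renewalLog1, Nat.reduceAdd, periodicSum,
    Fin.sum_univ_two, Fin.sum_univ_four, Matrix.of_apply, Matrix.cons_val, Fin.val_zero,
      Fin.val_one,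
    Fin.val_two, Fin.coe_ofNat_eq_mod, Nat.reduceMod, Nat.reduceSub, Nat.reduceDiv,
      Nat.cast_ofNat, Nat.cast_zero,
    Nat.cast_one]
  ring

theorem renewalLog_sum_initial_3 (la lb lc ld lx ly lz lt lp lq lD0 lC1 lC2 lr ls : ℝ) :
    renewalLog0 lp lq 2 +
      renewalLog1 lC1 lC2 lr ls 1 +
      renewalLog2 la lb lc ld lx ly lz lt lp lq lD0 0 =
    la + ld + lD0 + lq + lC1 := by
  simp only [renewalLog0, renewalLog1, renewalLog2, Nat.reduceAdd, periodicSum,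
    Fin.sum_univ_two, Fin.sum_univ_four, Matrix.of_apply, Matrix.cons_val, Fin.val_zero,
      Fin.val_one,
    Fin.val_two, Fin.coe_ofNat_eq_mod, Nat.reduceMod, Nat.reduceSub, Nat.reduceDiv,
      Nat.cast_ofNat, Nat.cast_zero,
    Nat.cast_one]
  ring

theorem renewalLog_sum_initial_4 (la lb lc ld lx ly lz lt lp lq lD0 lC1 lC2 lr ls : ℝ) :
    renewalLog0 lp lq 3 +
      renewalLog1 lC1 lC2 lr ls 2 +
      renewalLog2 la lb lc ld lx ly lz lt lp lq lD0 1 +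
      renewalLog3 la lb lc ld lx ly lz lt lC1 lC2 lr ls 0 =
    la + ld + lx + lt + 2 * lD0 + 2 * lC1 := by
  simp only [renewalLog0, renewalLog1, renewalLog2, renewalLog3, Nat.reduceAdd, periodicSum,
    Fin.sum_univ_two, Fin.sum_univ_four, Matrix.of_apply, Matrix.cons_val, Fin.val_zero,
      Fin.val_one,
    Fin.val_two, Fin.coe_ofNat_eq_mod, Nat.reduceMod, Nat.reduceSub, Nat.reduceDiv,
      Nat.cast_ofNat, Nat.cast_zero,
    Nat.cast_one]
  ring

theorem renewalLog_sum_initial_5 (la lb lc ld lx ly lz lt lp lq lD0 lC1 lC2 lr ls : ℝ) :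
    renewalLog0 lp lq 4 +
      renewalLog1 lC1 lC2 lr ls 3 +
      renewalLog2 la lb lc ld lx ly lz lt lp lq lD0 2 +
      renewalLog3 la lb lc ld lx ly lz lt lC1 lC2 lr ls 1 +
      renewalLog4 lp lq lr ls 0 =
    la + lb + lc + ld + lx + lt + 3 * lD0 + 2 * lC1 + lC2 := by
  simp only [renewalLog0, renewalLog1, renewalLog2, renewalLog3, renewalLog4, Nat.reduceAdd,
    periodicSum,
    Fin.sum_univ_two, Fin.sum_univ_four, Matrix.of_apply, Matrix.cons_val, Fin.val_zero,
      Fin.val_one,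
    Fin.val_two, Fin.coe_ofNat_eq_mod, Nat.reduceMod, Nat.reduceSub, Nat.reduceDiv,
      Nat.cast_ofNat, Nat.cast_zero,
    Nat.cast_one]
  ring

theorem renewalLog_sum_initial_6 (la lb lc ld lx ly lz lt lp lq lD0 lC1 lC2 lr ls le lf lE1 lE2 :
  ℝ) :
    renewalLog0 lp lq 5 +
      renewalLog1 lC1 lC2 lr ls 4 +
      renewalLog2 la lb lc ld lx ly lz lt lp lq lD0 3 +
      renewalLog3 la lb lc ld lx ly lz lt lC1 lC2 lr ls 2 +
      renewalLog4 lp lq lr ls 1 +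
      renewalLog5 la lb lc ld lx ly lz lt le lf lE1 lE2 0 =
    la + lb + lc + ld + lx + ly + lz + lt + 4 * lD0 + le + 2 * lC1 + 2 * lC2 := by
  simp only [renewalLog0, renewalLog1, renewalLog2, renewalLog3, renewalLog4, renewalLog5,
    Nat.reduceAdd, periodicSum,
    Fin.sum_univ_two, Fin.sum_univ_four, Matrix.of_apply, Matrix.cons_val, Fin.val_zero,
      Fin.val_one,
    Fin.val_two, Fin.coe_ofNat_eq_mod, Nat.reduceMod, Nat.reduceSub, Nat.reduceDiv,
      Nat.cast_ofNat, Nat.cast_zero,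
    Nat.cast_one]
  ring

theorem renewalLog_sum_initial_7 (la lb lc ld lx ly lz lt lp lq lD0 lC1 lC2 lr ls le lf lE1 lE2 :
  ℝ) :
    renewalLog0 lp lq 6 +
      renewalLog1 lC1 lC2 lr ls 5 +
      renewalLog2 la lb lc ld lx ly lz lt lp lq lD0 4 +
      renewalLog3 la lb lc ld lx ly lz lt lC1 lC2 lr ls 3 +
      renewalLog4 lp lq lr ls 2 +
      renewalLog5 la lb lc ld lx ly lz lt le lf lE1 lE2 1 +
      renewalLog6 la lb lc ld lx ly lz lt lD0 0 =
    2 * la + lb + lc + 2 * ld + 2 * lx + ly + lz + 2 * lt + 6 * lD0 + lE1 + 3 * lC1 + 2 * lC2 := by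
  simp only [renewalLog0, renewalLog1, renewalLog2, renewalLog3, renewalLog4, renewalLog5,
    renewalLog6, Nat.reduceAdd, periodicSum,
    Fin.sum_univ_two, Fin.sum_univ_four, Matrix.of_apply, Matrix.cons_val, Fin.val_zero,
      Fin.val_one,
    Fin.val_two, Fin.coe_ofNat_eq_mod, Nat.reduceMod, Nat.reduceSub, Nat.reduceDiv,
      Nat.cast_ofNat, Nat.cast_zero,
    Nat.cast_one]
  ring

/-! ### The chain of renewals and the theorem. -/

/-- `F1`, …, `F7` stand for the logarithms of the generating functions of the seven intermediate
patterns. Only their recursion and their vanishing at order `0` matter, so the patterns themselves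
are hidden. -/
theorem exists_log_renewal_chain {a b c d x y z t p q D0 C1 C2 r s e f E1 E2 : ℝ}
    (ha : 0 < a) (hb : 0 < b) (hc : 0 < c) (hd : 0 < d)
    (hx : 0 < x) (hy : 0 < y) (hz : 0 < z) (ht : 0 < t)
    (h_p : p = a * c + b * d) (h_q : q = x * z + y * t) (h_D0 : D0 = p + q)
    (h_C1 : C1 = x * t * p ^ 2 + a * d * q ^ 2) (h_C2 : C2 = y * z * p ^ 2 + b * c * q ^ 2)
    (h_r : r = a * c * q ^ 2 + y * t * p ^ 2) (h_s : s = b * d * q ^ 2 + x * z * p ^ 2)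
    (h_e : e = b * d + x * z) (h_f : f = a * c + y * t)
    (h_E1 : E1 = a * d + x * t) (h_E2 : E2 = b * c + y * z) :
    ∃ F1 F2 F3 F4 F5 F6 F7 : ℕ → ℝ,
      (∀ n, 0 < diamondSum n True (periodicWeight (patternN a b c d x y z t))) ∧
      (F1 0 = 0 ∧ F2 0 = 0 ∧ F3 0 = 0 ∧ F4 0 = 0 ∧ F5 0 = 0 ∧ F6 0 = 0 ∧ F7 0 = 0) ∧
      (∀ n, Real.log (diamondSum (n + 1) True (periodicWeight (patternN a b c d x y z t))) =
        renewalLog0 (Real.log p) (Real.log q) n +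
          F1 n) ∧
      (∀ n, F1 (n + 1) =
        renewalLog1 (Real.log C1) (Real.log C2) (Real.log r) (Real.log s) n +
          F2 n) ∧
      (∀ n, F2 (n + 1) =
        renewalLog2 (Real.log a) (Real.log b) (Real.log c) (Real.log d) (Real.log x) (Real.log y)
          (Real.log z) (Real.log t) (Real.log p) (Real.log q) (Real.log D0) n +
          F3 n) ∧
      (∀ n, F3 (n + 1) =
        renewalLog3 (Real.log a) (Real.log b) (Real.log c) (Real.log d) (Real.log x) (Real.log y)
          (Real.log z) (Real.log t) (Real.log C1) (Real.log C2) (Real.log r) (Real.log s) n +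
          F4 n) ∧
      (∀ n, F4 (n + 1) =
        renewalLog4 (Real.log p) (Real.log q) (Real.log r) (Real.log s) n +
          F5 n) ∧
      (∀ n, F5 (n + 1) =
        renewalLog5 (Real.log a) (Real.log b) (Real.log c) (Real.log d) (Real.log x) (Real.log y)
          (Real.log z) (Real.log t) (Real.log e) (Real.log f) (Real.log E1) (Real.log E2) n +
          F6 n) ∧
      (∀ n, F6 (n + 1) =
        renewalLog6 (Real.log a) (Real.log b) (Real.log c) (Real.log d) (Real.log x) (Real.log y)
          (Real.log z) (Real.log t) (Real.log D0) n +
          F7 n) ∧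
      (∀ n, F7 (n + 1) =
        renewalLog7 (Real.log a) (Real.log b) (Real.log c) (Real.log d) (Real.log x) (Real.log y)
          (Real.log z) (Real.log t) (Real.log e) (Real.log f) (Real.log E1) (Real.log E2) n +
          Real.log (diamondSum n True (periodicWeight (patternN a b c d x y z t)))) := by
  have hp : 0 < p := by rw [h_p]; positivity
  have hq : 0 < q := by rw [h_q]; positivity
  have hD0 : 0 < D0 := by rw [h_D0]; positivity
  have hC1 : 0 < C1 := by rw [h_C1]; positivity
  have hC2 : 0 < C2 := by rw [h_C2]; positivity
  have hr : 0 < r := by rw [h_r]; positivity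
  have hs : 0 < s := by rw [h_s]; positivity
  have he : 0 < e := by rw [h_e]; positivity
  have hf : 0 < f := by rw [h_f]; positivity
  have hE1 : 0 < E1 := by rw [h_E1]; positivity
  have hE2 : 0 < E2 := by rw [h_E2]; positivity
  -- These two identities are what makes the cell weights factor in the third and the seventh
  -- renewal.
  have hrs : r + s = p * q * D0 := by rw [h_r, h_s, h_D0, h_p, h_q]; ring
  have hef : e + f = D0 := by rw [h_e, h_f, h_D0, h_p, h_q]; ring
  have s0 (n : ℕ) := log_diamondSum_patternN hp hq h_p h_q (n := n)
  have s1 (n : ℕ) := log_diamondSum_patternRenewed1 hr hs hC1 hC2 h_C1 h_C2 h_r h_s (n := n)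
  have s2 (n : ℕ) := log_diamondSum_patternRenewed2 ha hb hc hd hx hy hz ht hp hq hD0 hr hs hrs
    (n := n)
  have s3 (n : ℕ) := log_diamondSum_patternRenewed3 ha hb hc hd hx hy hz ht hp hq hC1 hC2 hr hs
    h_C1 h_C2 h_r h_s (n := n)
  have s4 (n : ℕ) := log_diamondSum_patternRenewed4 ha hb hc hd hx hy hz ht hp hq hr hs h_p h_q
    (n := n)
  have s5 (n : ℕ) := log_diamondSum_patternRenewed5 ha hb hc hd hx hy hz ht he hf hE1 hE2 h_e h_f
    h_E1 h_E2 (n := n)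
  have s6 (n : ℕ) := log_diamondSum_patternRenewed6 ha hb hc hd hx hy hz ht hD0 he hf hef (n := n)
  have s7 (n : ℕ) := log_diamondSum_patternRenewed7 ha hb hc hd hx hy hz ht he hf hE1 hE2 h_e h_f
    h_E1 h_E2 (n := n)
  -- The induction must run over all eight patterns at once, because order `n + 1` of one pattern
  -- rests on order `n` of the next one in the cycle.
  have pos (n : ℕ) : 0 < diamondSum n True (periodicWeight (patternN a b c d x y z t)) ∧
      0 < diamondSum n True (periodicWeight (patternRenewed1 a b c d x y z t p q)) ∧
      0 < diamondSum n True (periodicWeight (patternRenewed2 a b c d x y z t p q r s)) ∧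
      0 < diamondSum n True (periodicWeight (patternRenewed3 a b c d x y z t p q r s)) ∧
      0 < diamondSum n True (periodicWeight (patternRenewed4 a b c d x y z t p q r s)) ∧
      0 < diamondSum n True (periodicWeight (patternRenewed5 a b c d x y z t)) ∧
      0 < diamondSum n True (periodicWeight (patternRenewed6 a b c d x y z t e f)) ∧
      0 < diamondSum n True (periodicWeight (patternRenewed7 a b c d x y z t e f)) := by
    induction n with
    | zero => simp only [diamondSum_zero, zero_lt_one, and_self]
    | succ n ih =>
      obtain ⟨i0, i1, i2, i3, i4, i5, i6, i7⟩ := ih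
      exact ⟨(s0 n i1).1, (s1 n i2).1, (s2 n i3).1, (s3 n i4).1, (s4 n i5).1, (s5 n i6).1,
        (s6 n i7).1, (s7 n i0).1⟩
  refine ⟨fun n => Real.log (diamondSum n True (periodicWeight
    (patternRenewed1 a b c d x y z t p q))),
    fun n => Real.log (diamondSum n True (periodicWeight (patternRenewed2 a b c d x y z t p q r
      s))),
    fun n => Real.log (diamondSum n True (periodicWeight (patternRenewed3 a b c d x y z t p q r
      s))),
    fun n => Real.log (diamondSum n True (periodicWeight (patternRenewed4 a b c d x y z t p q r
      s))),
    fun n => Real.log (diamondSum n True (periodicWeight (patternRenewed5 a b c d x y z t))),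
    fun n => Real.log (diamondSum n True (periodicWeight (patternRenewed6 a b c d x y z t e f))),
    fun n => Real.log (diamondSum n True (periodicWeight (patternRenewed7 a b c d x y z t e f))),
    fun n => (pos n).1, ?_, ?_⟩
  · simp only [diamondSum_zero, Real.log_one, and_self]
  · exact ⟨fun n => (s0 n (pos n).2.1).2, fun n => (s1 n (pos n).2.2.1).2,
      fun n => (s2 n (pos n).2.2.2.1).2, fun n => (s3 n (pos n).2.2.2.2.1).2,
      fun n => (s4 n (pos n).2.2.2.2.2.1).2, fun n => (s5 n (pos n).2.2.2.2.2.2.1).2,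
      fun n => (s6 n (pos n).2.2.2.2.2.2.2).2, fun n => (s7 n (pos n).1).2⟩

theorem mainTheorem11 (a b c d x y z t : ℝ)
    (ha : 0 < a) (hb : 0 < b) (hc : 0 < c) (hd : 0 < d)
    (hx : 0 < x) (hy : 0 < y) (hz : 0 < z) (ht : 0 < t)
    (Δ₀ Δ₁ Δ₂ C₁ C₂ C₃ : ℝ)
    (hΔ₁ : Δ₁ = a * c + b * d) (hΔ₂ : Δ₂ = x * z + y * t) (hΔ₀ : Δ₀ = Δ₁ + Δ₂)
    (hC₁ : C₁ = x * t * Δ₁ ^ 2 + a * d * Δ₂ ^ 2)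
    (hC₂ : C₂ = y * z * Δ₁ ^ 2 + b * c * Δ₂ ^ 2)
    (hC₃ : C₃ = a * c * Δ₂ ^ 2 + y * t * Δ₁ ^ 2)
    (N : Matrix (Fin 4) (Fin 8) ℝ) (hN : N = patternN a b c d x y z t) :
    (∀ n : ℕ, 2 ≤ n →
      aztecM (4 * n) N / aztecM (4 * n - 8) N =
        Δ₀ ^ (8 * n - 8) * (a * d + x * t) ^ (2 * n - 2) * (b * c + y * z) ^ (2 * n - 4) *
          C₁ ^ (2 * n) * C₂ ^ (2 * n - 2) *
          (a ^ (2 * n - 1) * b ^ (2 * n - 3) * c ^ (2 * n - 3) * d ^ (2 * n - 1) *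
            x ^ (2 * n - 1) * y ^ (2 * n - 3) * z ^ (2 * n - 3) * t ^ (2 * n - 1)) ∧
      aztecM (4 * n + 1) N / aztecM (4 * n - 7) N =
        Δ₀ ^ (8 * n - 6) * (a * d + x * t) ^ (2 * n - 2) * (b * c + y * z) ^ (2 * n - 3) *
          C₁ ^ (2 * n) * C₂ ^ (2 * n - 1) *
          (a ^ (2 * n - 1) * b ^ (2 * n - 2) * c ^ (2 * n - 2) * d ^ (2 * n - 1) *
            x ^ (2 * n - 1) * y ^ (2 * n - 2) * z ^ (2 * n - 2) * t ^ (2 * n - 1)) ∧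
      aztecM (4 * n + 2) N / aztecM (4 * n - 6) N =
        Δ₀ ^ (8 * n - 4) * (a * d + x * t) ^ (2 * n - 2) * (b * c + y * z) ^ (2 * n - 2) *
          C₁ ^ (2 * n) * C₂ ^ (2 * n) *
          (a ^ (2 * n - 1) * b ^ (2 * n - 1) * c ^ (2 * n - 1) * d ^ (2 * n - 1) *
            x ^ (2 * n - 1) * y ^ (2 * n - 1) * z ^ (2 * n - 1) * t ^ (2 * n - 1)) ∧
      aztecM (4 * n + 3) N / aztecM (4 * n - 5) N =
        Δ₀ ^ (8 * n - 2) * (a * d + x * t) ^ (2 * n - 1) * (b * c + y * z) ^ (2 * n - 2) *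
          C₁ ^ (2 * n + 1) * C₂ ^ (2 * n) *
          (a ^ (2 * n) * b ^ (2 * n - 1) * c ^ (2 * n - 1) * d ^ (2 * n) *
            x ^ (2 * n) * y ^ (2 * n - 1) * z ^ (2 * n - 1) * t ^ (2 * n))) ∧
    aztecM 0 N = 1 ∧
    aztecM 1 N = Δ₁ ∧
    aztecM 2 N = C₃ ∧
    aztecM 3 N = a * d * Δ₀ * Δ₂ * C₁ ∧
    aztecM 4 N = a * d * x * t * Δ₀ ^ 2 * C₁ ^ 2 ∧
    aztecM 5 N = a * b * c * d * x * t * Δ₀ ^ 3 * C₁ ^ 2 * C₂ ∧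
    aztecM 6 N = a * b * c * d * x * y * z * t * Δ₀ ^ 4 * (b * d + x * z) * C₁ ^ 2 * C₂ ^ 2 ∧
    aztecM 7 N = a ^ 2 * b * c * d ^ 2 * x ^ 2 * y * z * t ^ 2 * Δ₀ ^ 6 * (a * d + x * t) *
      C₁ ^ 3 * C₂ ^ 2 := by
  subst hN
  -- Passing `hC₃` identifies `r` with `C₃`; the proofs `rfl` introduce `s`, `e`, `f`, `E1` and `E2`
  -- by their formulas.
  obtain ⟨F1, F2, F3, F4, F5, F6, F7, pos, ⟨z1, z2, z3, z4, z5, z6, z7⟩, s0, s1, s2, s3, s4, s5, s6,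
    s7⟩ := exists_log_renewal_chain ha hb hc hd hx hy hz ht hΔ₁ hΔ₂ hΔ₀ hC₁ hC₂ hC₃ rfl rfl rfl
      rfl rfl
  have haz (n : ℕ) : aztecM n (patternN a b c d x y z t) =
      diamondSum n True (periodicWeight (patternN a b c d x y z t)) :=
    matchingGenFun_aztecGraph n _
  have z0 := diamondSum_zero (periodicWeight (patternN a b c d x y z t))
  have h₁ : 0 < Δ₁ := by rw [hΔ₁]; positivity
  have h₂ : 0 < Δ₂ := by rw [hΔ₂]; positivity
  have h₀ : 0 < Δ₀ := by rw [hΔ₀]; positivity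
  have h₃ : 0 < C₁ := by rw [hC₁]; positivity
  have h₄ : 0 < C₂ := by rw [hC₂]; positivity
  have h₅ : 0 < C₃ := by rw [hC₃]; positivity
  simp only [haz]
  have of_log {u v : ℝ} (hu : 0 < u) (hv : 0 < v) (h : Real.log u = Real.log v) : u = v :=
    Real.log_injOn_pos hu hv h
  refine ⟨fun n hn => ?_, z0, ?_, ?_, ?_, ?_, ?_, ?_, ?_⟩
  -- With `n = m + 2` all truncated subtractions become sums in `m`; the smallest exponent, `2n -
  -- 4`, becomes `2m`.
  · obtain ⟨m, rfl⟩ : ∃ m, n = m + 2 := ⟨n - 2, by omega⟩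
    refine ⟨?_, ?_, ?_, ?_⟩
    · rw [show 4 * (m + 2) - 8 = 4 * m + 0 by omega, show 4 * (m + 2) = 4 * m + 7 + 1 by omega,
        show 8 * (m + 2) - 8 = 8 * m + 8 by omega,
        show 2 * (m + 2) - 2 = 2 * m + 2 by omega,
        show 2 * (m + 2) - 4 = 2 * m by omega,
        show 2 * (m + 2) - 1 = 2 * m + 3 by omega,
        show 2 * (m + 2) - 3 = 2 * m + 1 by omega]
      refine of_log (div_pos (pos _) (pos _)) (by positivity) ?_
      have key := renewalLog_sum_four_mul_add_0 (Real.log a) (Real.log b) (Real.log c)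
        (Real.log d) (Real.log x) (Real.log y) (Real.log z) (Real.log t) (Real.log Δ₁)
        (Real.log Δ₂) (Real.log Δ₀) (Real.log C₁) (Real.log C₂) (Real.log C₃) (Real.log
        (b * d * Δ₂ ^ 2 + x * z * Δ₁ ^ 2)) (Real.log (b * d + x * z)) (Real.log (a * c + y * t))
        (Real.log (a * d + x * t)) (Real.log (b * c + y * z)) m
      -- Eight rewrites run once through the cycle and end at the logarithm of the denominator,
      -- which cancels.
      rw [Real.log_div (pos _).ne' (pos _).ne', s0, s1, s2, s3, s4, s5, s6, s7]
      simp (disch := positivity) only [Real.log_mul, Real.log_pow]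
      push_cast
      linear_combination key
    · rw [show 4 * (m + 2) - 7 = 4 * m + 1 by omega, show 4 * (m + 2) + 1 = 4 * m + 8 + 1 by omega,
        show 8 * (m + 2) - 6 = 8 * m + 10 by omega,
        show 2 * (m + 2) - 2 = 2 * m + 2 by omega,
        show 2 * (m + 2) - 3 = 2 * m + 1 by omega,
        show 2 * (m + 2) - 1 = 2 * m + 3 by omega]
      refine of_log (div_pos (pos _) (pos _)) (by positivity) ?_
      have key := renewalLog_sum_four_mul_add_1 (Real.log a) (Real.log b) (Real.log c)
        (Real.log d) (Real.log x) (Real.log y) (Real.log z) (Real.log t) (Real.log Δ₁)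
        (Real.log Δ₂) (Real.log Δ₀) (Real.log C₁) (Real.log C₂) (Real.log C₃) (Real.log
        (b * d * Δ₂ ^ 2 + x * z * Δ₁ ^ 2)) (Real.log (b * d + x * z)) (Real.log (a * c + y * t))
        (Real.log (a * d + x * t)) (Real.log (b * c + y * z)) m
      rw [Real.log_div (pos _).ne' (pos _).ne', s0, s1, s2, s3, s4, s5, s6, s7]
      simp (disch := positivity) only [Real.log_mul, Real.log_pow]
      push_cast
      linear_combination key
    · rw [show 4 * (m + 2) - 6 = 4 * m + 2 by omega, show 4 * (m + 2) + 2 = 4 * m + 9 + 1 by omega,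
        show 8 * (m + 2) - 4 = 8 * m + 12 by omega,
        show 2 * (m + 2) - 2 = 2 * m + 2 by omega,
        show 2 * (m + 2) - 1 = 2 * m + 3 by omega]
      refine of_log (div_pos (pos _) (pos _)) (by positivity) ?_
      have key := renewalLog_sum_four_mul_add_2 (Real.log a) (Real.log b) (Real.log c)
        (Real.log d) (Real.log x) (Real.log y) (Real.log z) (Real.log t) (Real.log Δ₁)
        (Real.log Δ₂) (Real.log Δ₀) (Real.log C₁) (Real.log C₂) (Real.log C₃) (Real.log
        (b * d * Δ₂ ^ 2 + x * z * Δ₁ ^ 2)) (Real.log (b * d + x * z)) (Real.log (a * c + y * t))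
        (Real.log (a * d + x * t)) (Real.log (b * c + y * z)) m
      rw [Real.log_div (pos _).ne' (pos _).ne', s0, s1, s2, s3, s4, s5, s6, s7]
      simp (disch := positivity) only [Real.log_mul, Real.log_pow]
      push_cast
      linear_combination key
    · rw [show 4 * (m + 2) - 5 = 4 * m + 3 by omega, show 4 * (m + 2) + 3 = 4 * m + 10 + 1 by omega,
        show 8 * (m + 2) - 2 = 8 * m + 14 by omega,
        show 2 * (m + 2) - 1 = 2 * m + 3 by omega,
        show 2 * (m + 2) - 2 = 2 * m + 2 by omega]
      refine of_log (div_pos (pos _) (pos _)) (by positivity) ?_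
      have key := renewalLog_sum_four_mul_add_3 (Real.log a) (Real.log b) (Real.log c)
        (Real.log d) (Real.log x) (Real.log y) (Real.log z) (Real.log t) (Real.log Δ₁)
        (Real.log Δ₂) (Real.log Δ₀) (Real.log C₁) (Real.log C₂) (Real.log C₃) (Real.log
        (b * d * Δ₂ ^ 2 + x * z * Δ₁ ^ 2)) (Real.log (b * d + x * z)) (Real.log (a * c + y * t))
        (Real.log (a * d + x * t)) (Real.log (b * c + y * z)) m
      rw [Real.log_div (pos _).ne' (pos _).ne', s0, s1, s2, s3, s4, s5, s6, s7]
      simp (disch := positivity) only [Real.log_mul, Real.log_pow]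
      push_cast
      linear_combination key
  · refine of_log (pos _) (by positivity) ?_
    have key := renewalLog_sum_initial_1 (Real.log Δ₁) (Real.log Δ₂)
    -- The chain stops at the empty diamond, where the logarithm is zero.
    rw [s0, z1]
    linear_combination key
  · refine of_log (pos _) (by positivity) ?_
    have key := renewalLog_sum_initial_2 (Real.log Δ₁) (Real.log Δ₂) (Real.log C₁) (Real.log C₂)
      (Real.log C₃) (Real.log (b * d * Δ₂ ^ 2 + x * z * Δ₁ ^ 2))
    rw [s0, s1, z2]
    linear_combination key
  · refine of_log (pos _) (by positivity) ?_
    have key := renewalLog_sum_initial_3 (Real.log a) (Real.log b) (Real.log c) (Real.log d)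
      (Real.log x) (Real.log y) (Real.log z) (Real.log t) (Real.log Δ₁) (Real.log Δ₂)
      (Real.log Δ₀) (Real.log C₁) (Real.log C₂) (Real.log C₃) (Real.log
      (b * d * Δ₂ ^ 2 + x * z * Δ₁ ^ 2))
    rw [s0, s1, s2, z3]
    simp (disch := positivity) only [Real.log_mul, Real.log_pow]
    push_cast
    linear_combination key
  · refine of_log (pos _) (by positivity) ?_
    have key := renewalLog_sum_initial_4 (Real.log a) (Real.log b) (Real.log c) (Real.log d)
      (Real.log x) (Real.log y) (Real.log z) (Real.log t) (Real.log Δ₁) (Real.log Δ₂)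
      (Real.log Δ₀) (Real.log C₁) (Real.log C₂) (Real.log C₃) (Real.log
      (b * d * Δ₂ ^ 2 + x * z * Δ₁ ^ 2))
    rw [s0, s1, s2, s3, z4]
    simp (disch := positivity) only [Real.log_mul, Real.log_pow]
    push_cast
    linear_combination key
  · refine of_log (pos _) (by positivity) ?_
    have key := renewalLog_sum_initial_5 (Real.log a) (Real.log b) (Real.log c) (Real.log d)
      (Real.log x) (Real.log y) (Real.log z) (Real.log t) (Real.log Δ₁) (Real.log Δ₂)
      (Real.log Δ₀) (Real.log C₁) (Real.log C₂) (Real.log C₃) (Real.log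
      (b * d * Δ₂ ^ 2 + x * z * Δ₁ ^ 2))
    rw [s0, s1, s2, s3, s4, z5]
    simp (disch := positivity) only [Real.log_mul, Real.log_pow]
    push_cast
    linear_combination key
  · refine of_log (pos _) (by positivity) ?_
    have key := renewalLog_sum_initial_6 (Real.log a) (Real.log b) (Real.log c) (Real.log d)
      (Real.log x) (Real.log y) (Real.log z) (Real.log t) (Real.log Δ₁) (Real.log Δ₂)
      (Real.log Δ₀) (Real.log C₁) (Real.log C₂) (Real.log C₃) (Real.log
      (b * d * Δ₂ ^ 2 + x * z * Δ₁ ^ 2)) (Real.log (b * d + x * z)) (Real.log (a * c + y * t))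
      (Real.log (a * d + x * t)) (Real.log (b * c + y * z))
    rw [s0, s1, s2, s3, s4, s5, z6]
    simp (disch := positivity) only [Real.log_mul, Real.log_pow]
    push_cast
    linear_combination key
  · refine of_log (pos _) (by positivity) ?_
    have key := renewalLog_sum_initial_7 (Real.log a) (Real.log b) (Real.log c) (Real.log d)
      (Real.log x) (Real.log y) (Real.log z) (Real.log t) (Real.log Δ₁) (Real.log Δ₂)
      (Real.log Δ₀) (Real.log C₁) (Real.log C₂) (Real.log C₃) (Real.log
      (b * d * Δ₂ ^ 2 + x * z * Δ₁ ^ 2)) (Real.log (b * d + x * z)) (Real.log (a * c + y * t))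
      (Real.log (a * d + x * t)) (Real.log (b * c + y * z))
    rw [s0, s1, s2, s3, s4, s5, s6, z7]
    simp (disch := positivity) only [Real.log_mul, Real.log_pow]
    push_cast
    linear_combination key
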